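/- Let $\mathbb{F}_q$ be a finite field, $A=\mathbb{F}_q[\theta]$, $k=\mathbb{F}_q(\theta)$, $v\in A$ monic irreducible, $q_v=q^{\deg v}$, $k_v$ the completion of $k$ at $v$ with normalized valuation $\mathrm{ord}_v$ and valuation ring $A_v$, and $\tau$ the $q$-th power map. Let $r\ge 1$, $\mathfrak{s}=(s_1,\dots,s_r)$ with $s_i\in\mathbb{Z}_{\ge1}$, $\mathrm{wt}(\mathfrak{s})=s_1+\cdots+s_r$, and $\mathbf{u}=(u_1,\dots,u_r)\in A^r$. Put $d_\ell=s_\ell+\cdots+s_r$ and $d=d_1+\cdots+d_r$, and let $G_{\mathfrak{s},\mathbf{u}}=(\mathbb{G}_a^d,\rho)$ be the $t$-module with $\rho_t=\theta I_d+N+E\tau$. Here $N$ is block diagonal with blocks the nilpotent upper Jordan blocks of sizes $d_1,\dots,d_r$, and $E$ is block upper triangular, its block $(\ell,m)$ for $\ell\le m$ having lower left entry $(-1)^{m-\ell}\prod_{e=\ell}^{m-1}u_e$ and all other entries $0$. Its exponential is the unique series $\exp_G=\sum_{i\ge0}Q_i\tau^i$ with $Q_0=I_d$ and $\exp_G\circ(\theta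 I_d+N)=\rho_t\circ\exp_G$, and $\log_G$ is the formal inverse of $\exp_G$. Let $\mathbf{v}_{\mathfrak{s},\mathbf{u}}\in A^d$ be the point whose last coordinate in the $\ell$-th block is $(-1)^{r-\ell}u_\ell\cdots u_r$ and whose other coordinates are $0$. With $\tilde{\mathfrak{s}}=(s_r,\dots,s_1)$, $\tilde{\mathbf{u}}=(u_r,\dots,u_1)$ and $G=G_{\tilde{\mathfrak{s}},\tilde{\mathbf{u}}}$, the $v$-adic Carlitz multiple star polylogarithm (CMSPL) value is $$\mathrm{Li}^\star_{\mathfrak{s}}(\mathbf{u})_v=\frac{(-1)^{r-1}}{a(\theta)}\times\bigl(\text{the }(s_1+\cdots+s_r)\text{-th coordinate of }\log_G(\rho_a(\mathbf{v}_{\tilde{\mathfrak{s}},\tilde{\mathbf{u}}}))\bigr)\in k_v$$ for any nonzero $a\in\mathbb{F}_q[t]$ such that all coordinates of $\rho_a(\mathbf{v}_{\tilde{\mathfrak{s}},\tilde{\mathbf{u}}})$ have $v$-adic absolute value $<1$. Such $a$ exist, the logarithm then converges $v$-adically, and the value does not depend on $a$; so $\mathrm{Li}^\star_{\mathfrak{s}}(\mathbf{u})_v$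 is well defined. Let $S_{0,v}=S^\star_{0,v}=\{1\}$. For $w\ge1$ let $S_{w,v}$ be the set of all $\mathrm{Li}^\star_{\mathfrak{s}}(\mathbf{u})_v$ with $r\ge1$, $\mathrm{wt}(\mathfrak{s})=w$, $\mathbf{u}\in A^r$, and let $S^\star_{w,v}$ be the set of those with $\mathbf{u}\in vA\times A^{r-1}$. Let $\mathcal{L}_{w,v}$ be the $k$-span of $S_{w,v}$ in $k_v$. Then: (1) For every $w\ge0$, $\mathcal{L}_{w,v}$ is spanned over $k$ by $S^\star_{w,v}$, and $\mathcal{L}_v=\sum_{w\ge0}\mathcal{L}_{w,v}$ is a $k$-subalgebra of $k_v$. (2) Let $B_{w,v}=\min_{n\ge0}\{q_v^n-n w\}$. For all $r\ge1$, $\mathfrak{s}$ and $\mathbf{u}\in A^r$, $$\mathrm{ord}_v(\mathrm{Li}^\star_{\mathfrak{s}}(\mathbf{u})_v)\ge B_{\mathrm{wt}(\mathfrak{s}),v},$$ and in particular $\mathrm{Li}^\star_{\mathfrak{s}}(\mathbf{u})_v\in A_v$ if $q_v\ge\mathrm{wt}(\mathfrak{s})$. -/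

import Mathlib

open Polynomial Matrix

noncomputable section

namespace CMSPL

/-! `F = 𝔽_q`, `A = F[X]` with `θ = X`, `k = RatFunc F`.  An index of depth `r + 1` is a function
`s : Fin (r + 1) → ℕ+`; positions are counted from `0`. -/

/-- The weight `s_1 + ⋯ + s_r`. -/
def wt {r : ℕ} (s : Fin (r + 1) → ℕ+) : ℕ := ∑ i, (s i : ℕ)

/-- The block sizes `d_ℓ = s_ℓ + ⋯ + s_r`. -/
def blockSize {r : ℕ} (s : Fin (r + 1) → ℕ+) (l : Fin (r + 1)) : ℕ :=
  ∑ m ∈ Finset.Ici l, (s m : ℕ)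

theorem blockSize_pos {r : ℕ} (s : Fin (r + 1) → ℕ+) (l : Fin (r + 1)) : 0 < blockSize s l :=
  Finset.sum_pos (fun m _ => (s m).pos) ⟨l, Finset.mem_Ici.2 le_rfl⟩

/-- The `d = d_1 + ⋯ + d_r` coordinates, grouped in blocks: `⟨ℓ, j⟩` is the `j`-th coordinate of
the `ℓ`-th block. -/
abbrev Idx {r : ℕ} (s : Fin (r + 1) → ℕ+) : Type := (l : Fin (r + 1)) × Fin (blockSize s l)

/-- The `d_1`-th coordinate, i.e. the last one of the first block. -/
def lastOfFirst {r : ℕ} (s : Fin (r + 1) → ℕ+) : Idx s :=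
  ⟨0, ⟨blockSize s 0 - 1, Nat.sub_lt (blockSize_pos s 0) Nat.one_pos⟩⟩

/-- The block diagonal matrix `N` of nilpotent Jordan blocks. -/
def matN (F : Type*) [Field F] {r : ℕ} (s : Fin (r + 1) → ℕ+) : Matrix (Idx s) (Idx s) F[X] :=
  Matrix.of fun x y => if x.1 = y.1 ∧ (x.2 : ℕ) + 1 = (y.2 : ℕ) then 1 else 0

/-- The block upper triangular matrix `E`: for `ℓ ≤ m`, the lower left corner of the block
`E[ℓ m]` is `(-1)^(m-ℓ) ∏_{ℓ ≤ e < m} u_e`, and all other entries vanish. -/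
def matE {F : Type*} [Field F] {r : ℕ} (s : Fin (r + 1) → ℕ+) (u : Fin (r + 1) → F[X]) :
    Matrix (Idx s) (Idx s) F[X] :=
  Matrix.of fun x y =>
    if x.1 ≤ y.1 ∧ (x.2 : ℕ) + 1 = blockSize s x.1 ∧ (y.2 : ℕ) = 0 then
      (-1) ^ ((y.1 : ℕ) - (x.1 : ℕ)) * ∏ e ∈ Finset.Ico x.1 y.1, u e
    else 0

/-- `∂ρ_t = θ I + N`. -/
def dRho (F : Type*) [Field F] {r : ℕ} (s : Fin (r + 1) → ℕ+) : Matrix (Idx s) (Idx s) F[X] :=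
  (X : F[X]) • (1 : Matrix (Idx s) (Idx s) F[X]) + matN F s

/-- The special point: the last coordinate of block `ℓ` is the signed product
`± u_ℓ ⋯ u_r` (with sign `+` for the last block, then alternating), the others are `0`. -/
def specialPoint {F : Type*} [Field F] {r : ℕ} (s : Fin (r + 1) → ℕ+) (u : Fin (r + 1) → F[X]) :
    Idx s → F[X] := fun x =>
  if (x.2 : ℕ) + 1 = blockSize s x.1 then
    (-1) ^ (r - (x.1 : ℕ)) * ∏ e ∈ Finset.Ici x.1, u e
  else 0

/-- Coordinatewise `q`-th power Frobenius `τ` on `A^d`, as an `F`-linear map. -/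
def tau (F : Type*) [Field F] [Fintype F] (ι : Type*) : (ι → F[X]) →ₗ[F] (ι → F[X]) :=
  LinearMap.pi fun i => (FiniteField.frobeniusAlgHom F F[X]).toLinearMap ∘ₗ LinearMap.proj i

theorem tau_apply (F : Type*) [Field F] [Fintype F] (ι : Type*) (x : ι → F[X]) (i : ι) :
    tau F ι x i = x i ^ Fintype.card F := rfl

/-- `ρ_t = θ I + N + E τ`, acting on the points `A^d` of the `t`-module. -/
def rhoT {F : Type*} [Field F] [Fintype F] {r : ℕ} (s : Fin (r + 1) → ℕ+)
    (u : Fin (r + 1) → F[X]) : Module.End F (Idx s → F[X]) :=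
  (dRho F s).mulVecLin.restrictScalars F + (matE s u).mulVecLin.restrictScalars F ∘ₗ tau F (Idx s)

/-- `ρ_a` for `a ∈ 𝔽_q[t]`, acting on `A^d`. -/
def rho {F : Type*} [Field F] [Fintype F] {r : ℕ} (s : Fin (r + 1) → ℕ+)
    (u : Fin (r + 1) → F[X]) (a : F[X]) : Module.End F (Idx s → F[X]) :=
  aeval (rhoT s u) a

/-- Formal `𝔽_q`-linear power series `∑ P_i τ^i` with `P_i ∈ Mat(k)`. -/
abbrev TauSeries (F : Type*) [Field F] (ι : Type*) : Type _ := ℕ → Matrix ι ι (RatFunc F)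

/-- Composition of `𝔽_q`-linear power series, from `τ^i M = M^(i) τ^i`. -/
def TauSeries.comp {F : Type*} [Field F] [Fintype F] {ι : Type*} [Fintype ι]
    (P Q : TauSeries F ι) : TauSeries F ι := fun n =>
  ∑ ij ∈ Finset.HasAntidiagonal.antidiagonal n,
    P ij.1 * (Q ij.2).map (fun x => x ^ (Fintype.card F) ^ ij.1)

/-- A matrix over `A` as a constant series `M τ^0`. -/
def TauSeries.const {F : Type*} [Field F] {ι : Type*} (M : Matrix ι ι F[X]) : TauSeries F ι
  | 0 => M.map (algebraMap F[X] (RatFunc F))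
  | _ + 1 => 0

/-- `ρ_t = (θ I + N) + E τ` as a series. -/
def rhoSeries {F : Type*} [Field F] {r : ℕ} (s : Fin (r + 1) → ℕ+) (u : Fin (r + 1) → F[X]) :
    TauSeries F (Idx s)
  | 0 => (dRho F s).map (algebraMap F[X] (RatFunc F))
  | 1 => (matE s u).map (algebraMap F[X] (RatFunc F))
  | _ + 2 => 0

/-- `Q` is the exponential of the `t`-module: `Q = 1 + ⋯` and `Q ∘ ∂ρ_t = ρ_t ∘ Q`. As `t`
generates `𝔽_q[t]`, the same identity then holds for all `a ∈ 𝔽_q[t]`. -/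
def IsExp {F : Type*} [Field F] [Fintype F] {r : ℕ} (s : Fin (r + 1) → ℕ+)
    (u : Fin (r + 1) → F[X]) (Q : TauSeries F (Idx s)) : Prop :=
  Q 0 = 1 ∧ Q.comp (TauSeries.const (dRho F s)) = (rhoSeries s u).comp Q

/-- `P` is the logarithm of the `t`-module: the formal inverse of its exponential. -/
def IsLog {F : Type*} [Field F] [Fintype F] {r : ℕ} (s : Fin (r + 1) → ℕ+)
    (u : Fin (r + 1) → F[X]) (P : TauSeries F (Idx s)) : Prop :=
  ∃ Q : TauSeries F (Idx s), IsExp s u Q ∧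
    P.comp Q = TauSeries.const 1 ∧ Q.comp P = TauSeries.const 1

/-- The finite place of `k` given by an irreducible polynomial. -/
def place {F : Type*} [Field F] (v : F[X]) (hv : Irreducible v) :
    IsDedekindDomain.HeightOneSpectrum F[X] where
  asIdeal := Ideal.span {v}
  isPrime := (Ideal.span_singleton_prime hv.ne_zero).2 hv.prime
  ne_bot := by simpa [Ideal.span_singleton_eq_bot] using hv.ne_zero

/-- The completion `k_v`. -/
abbrev Kv {F : Type*} [Field F] (v : F[X]) (hv : Irreducible v) : Type _ :=
  (place v hv).adicCompletion (RatFunc F)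

/-- `q_v = q ^ deg v`. -/
def qv {F : Type*} [Field F] [Fintype F] (v : F[X]) : ℕ := Fintype.card F ^ v.natDegree

/-- `y` is the value of `log(z) = ∑ P_i τ^i(z)` at the point `z ∈ A^d`, the series
converging `v`-adically. -/
def IsLogValue {F : Type*} [Field F] [Fintype F] (v : F[X]) (hv : Irreducible v) {r : ℕ}
    (s : Fin (r + 1) → ℕ+) (u : Fin (r + 1) → F[X]) (z : Idx s → F[X])
    (y : Idx s → Kv v hv) : Prop :=
  ∃ P : TauSeries F (Idx s), IsLog s u P ∧
    HasSum (fun (i : ℕ) (c : Idx s) => algebraMap (RatFunc F) (Kv v hv)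
      ((P i *ᵥ fun b => algebraMap F[X] (RatFunc F) (z b) ^ (Fintype.card F) ^ i) c)) y

/-- `x` is the `v`-adic CMSPL value `Li*_s(u)_v`: for a nonzero `a ∈ 𝔽_q[t]` such that all
coordinates of `ρ_a` of the special point (for the reversed `s` and `u`) have `v`-adic absolute
value `< 1`, it is `(-1)^(depth-1) / a(θ)` times the `d_1`-th coordinate of the logarithm there. -/
def IsLi {F : Type*} [Field F] [Fintype F] (v : F[X]) (hv : Irreducible v) {r : ℕ}
    (s : Fin (r + 1) → ℕ+) (u : Fin (r + 1) → F[X]) (x : Kv v hv) : Prop :=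
  ∃ a : F[X], a ≠ 0 ∧
    (∀ c, (place v hv).valuation (RatFunc F) (algebraMap F[X] (RatFunc F)
      (rho (s ∘ Fin.rev) (u ∘ Fin.rev) a
        (specialPoint (s ∘ Fin.rev) (u ∘ Fin.rev)) c)) < 1) ∧
    ∃ y : Idx (s ∘ Fin.rev) → Kv v hv,
      IsLogValue v hv (s ∘ Fin.rev) (u ∘ Fin.rev)
        (rho (s ∘ Fin.rev) (u ∘ Fin.rev) a (specialPoint (s ∘ Fin.rev) (u ∘ Fin.rev))) y ∧
      x = algebraMap (RatFunc F) (Kv v hv) ((-1) ^ r / aeval (RatFunc.X : RatFunc F) a) *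
        y (lastOfFirst (s ∘ Fin.rev))

/-- `S_{w,v}`: the CMSPL values of weight `w` at points of `A^r`; `S_{0,v} = {1}`. -/
def S {F : Type*} [Field F] [Fintype F] (v : F[X]) (hv : Irreducible v) (w : ℕ) :
    Set (Kv v hv) :=
  if w = 0 then {1} else
    {x | ∃ (r : ℕ) (s : Fin (r + 1) → ℕ+) (u : Fin (r + 1) → F[X]), wt s = w ∧ IsLi v hv s u x}

/-- `S*_{w,v}`: the same with the first argument in `vA`. -/
def Sstar {F : Type*} [Field F] [Fintype F] (v : F[X]) (hv : Irreducible v) (w : ℕ) :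
    Set (Kv v hv) :=
  if w = 0 then {1} else
    {x | ∃ (r : ℕ) (s : Fin (r + 1) → ℕ+) (u : Fin (r + 1) → F[X]),
      wt s = w ∧ v ∣ u 0 ∧ IsLi v hv s u x}

/-- `𝓛_{w,v}`, the `k`-span of `S_{w,v}`. -/
def L {F : Type*} [Field F] [Fintype F] (v : F[X]) (hv : Irreducible v) (w : ℕ) :
    Submodule (RatFunc F) (Kv v hv) :=
  Submodule.span (RatFunc F) (S v hv w)

/-- `B_{w,v} = min_{n ≥ 0} (q_v^n - n w)`. -/
def B {F : Type*} [Field F] [Fintype F] (v : F[X]) (w : ℕ) : ℤ :=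
  ⨅ n : ℕ, ((qv v : ℤ) ^ n - n * w)

theorem one_lt_qv {F : Type*} [Field F] [Fintype F] {v : F[X]} (hv : Irreducible v) :
    1 < qv v :=
  Nat.one_lt_pow hv.natDegree_pos.ne' Fintype.one_lt_card

/-- The minimum defining `B_{w,v}` is attained. -/
theorem B_isLeast {F : Type*} [Field F] [Fintype F] {v : F[X]} (hv : Irreducible v) (w : ℕ) :
    IsLeast (Set.range fun n : ℕ => ((qv v : ℤ) ^ n - n * w)) (B v w) := by
  have hb : BddBelow (Set.range fun n : ℕ => ((qv v : ℤ) ^ n - n * w)) := by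
    refine ⟨-(w * w), ?_⟩
    rintro _ ⟨n, rfl⟩
    have h1 : ((n : ℤ)) < (qv v : ℤ) ^ n := by
      exact_mod_cast Nat.lt_pow_self (one_lt_qv hv)
    rcases le_total n w with h | h
    · have : (n : ℤ) * w ≤ w * w := by gcongr
      simp only
      linarith [Int.natCast_nonneg n]
    · induction n, h using Nat.le_induction with
      | base => simp only; linarith [Int.natCast_nonneg w]
      | succ m hm ih =>
        have hm' : ((m : ℤ)) < (qv v : ℤ) ^ m := by
          exact_mod_cast Nat.lt_pow_self (one_lt_qv hv)
        have := ih hm'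
        have h2 : (2 : ℤ) ≤ qv v := by exact_mod_cast one_lt_qv hv
        have h3 : (w : ℤ) ≤ m := by exact_mod_cast hm
        have h4 : 2 * (qv v : ℤ) ^ m ≤ qv v * (qv v : ℤ) ^ m :=
          mul_le_mul_of_nonneg_right h2 (by positivity)
        simp only at this ⊢
        rw [pow_succ']
        push_cast
        linarith
  exact ⟨Int.csInf_mem (Set.range_nonempty _) hb, fun y hy => csInf_le hb hy⟩

end CMSPL

end

/-!
The coordinate of `log_G` that defines the polylogarithm is explicit: with `λ_n = θ - θ^(q^n)` and
`L_n = ∏_{1 ≤ j ≤ n} λ_j`, the entry of its `n`-th coefficient at the `j`-th coordinate (counted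
from `0`) of block `l` is, up to sign, `λ_n^(d_l - 1 - j) / L_n^(d_l)` times a truncated star sum.
At a point divisible by `v` the powers of `λ_n` are absorbed through
`λ_n y^(q^n) = θ y^(q^n) - (θ y)^(q^n)`, so the partial sums of this coordinate are `A`-combinations
of truncated star sums of weight `w` with first argument in `vA`. The `n`-th increment of such a sum
has order at least `q^n - w ⌊n / deg v⌋ ≥ B_{w,v}`, which gives convergence and the bound, and
quasi-shuffle products of the truncated sums give the algebra.

A multiplier `a` prime to `v` exists because, modulo `v`, the coordinate sequences of an orbit of
`t` in block `l` satisfy `(t - θ)^(d_l) c = c^q` as soon as the later blocks vanish; iterating over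
the conjugates of `θ` shows that `v(t)^(d_l) - 1` kills the block. Independence of `a` is the
functional equation of the logarithm.
-/

noncomputable section

namespace CMSPL

open IsDedekindDomain Filter Topology

/-! ### The polynomials `θ - θ^(q^i)` -/

section lam

/-- The polynomial `λ_i = θ - θ^(q^i)`; up to sign it is Carlitz's `[i]`. -/
def lam (F : Type*) [Field F] [Fintype F] (i : ℕ) : F[X] := X - X ^ Fintype.card F ^ i

/-- Carlitz's `L_i = ∏_{1 ≤ j ≤ i} (θ - θ^(q^j))`, the denominators of his logarithm. -/
def lamProd (F : Type*) [Field F] [Fintype F] (i : ℕ) : F[X] := ∏ j ∈ Finset.range i, lam F (j + 1)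

variable {F : Type*} [Field F] [Fintype F] {v : F[X]} {i : ℕ}

theorem lamProd_zero : lamProd F 0 = 1 := rfl

theorem lamProd_succ (i : ℕ) : lamProd F (i + 1) = lamProd F i * lam F (i + 1) :=
  Finset.prod_range_succ _ _

theorem lam_separable (hi : i ≠ 0) : (lam F i).Separable := by
  obtain ⟨p, hp⟩ := CharP.exists F
  have hpq : p ∣ Fintype.card F ^ i :=
    dvd_pow ((CharP.cast_eq_zero_iff F p _).1 (FiniteField.cast_card_eq_zero F)) hi
  rw [lam, ← neg_sub, ← neg_one_mul]
  exact (galois_poly_separable p _ hpq).unit_mul isUnit_one.neg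

theorem lam_ne_zero (hi : i ≠ 0) : lam F i ≠ 0 := (lam_separable hi).ne_zero

theorem natDegree_dvd_of_dvd_lam (hv : Irreducible v) (h : v ∣ lam F i) : v.natDegree ∣ i := by
  refine hv.natDegree_dvd_of_dvd_X_pow_card_pow_sub_X ?_
  rwa [Nat.card_eq_fintype_card, ← dvd_neg, neg_sub]

theorem not_sq_dvd_lam (hv : Irreducible v) (hi : i ≠ 0) : ¬ v ^ 2 ∣ lam F i := fun h =>
  hv.not_isUnit ((lam_separable hi).squarefree v (by rwa [← sq]))

end lam

/-! ### Convergence in valued rings -/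

section Valued

open scoped WithZero

variable {R : Type*} [Ring R] [Valued R ℤᵐ⁰]

instance : NonarchimedeanRing R where
  is_nonarchimedean U hU := by
    obtain ⟨γ, hγ⟩ := Valued.mem_nhds_zero.1 hU
    exact ⟨⟨Valuation.ltAddSubgroup Valued.v.restrict γ, Valued.isOpen_ball _ _⟩, hγ⟩

variable {ι : Type*} {l : Filter ι} {a : ι → R} {φ : ι → ℤ}

theorem tendsto_zero_of_valued_le (hφ : Tendsto φ l atTop)
    (h : ∀ n, Valued.v (a n) ≤ WithZero.exp (-φ n)) : Tendsto a l (𝓝 0) := by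
  rw [(Valued.hasBasis_nhds_zero R _).tendsto_right_iff]
  intro γ _
  have hγ : MonoidWithZeroHom.ValueGroup₀.embedding γ.1 ≠ 0 := (_root_.map_ne_zero _).2 γ.ne_zero
  filter_upwards [hφ.eventually_gt_atTop
    (-(WithZero.log (MonoidWithZeroHom.ValueGroup₀.embedding γ.1)))] with n hn
  rw [Valuation.restrict_lt_iff_lt_embedding]
  refine (h n).trans_lt ?_
  rwa [← WithZero.exp_log hγ, WithZero.exp_lt_exp, neg_lt]

theorem valued_le_of_tendsto [l.NeBot] {x : R} (h : Tendsto a l (𝓝 x)) {c : ℤᵐ⁰}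
    (hc : ∀ n, Valued.v (a n) ≤ c) : Valued.v x ≤ c := by
  by_contra! hlt
  obtain ⟨n, hn⟩ := (h.eventually (Valued.locally_const (zero_le.trans_lt hlt).ne')).exists
  exact (hc n).not_gt (hn ▸ hlt)

theorem summable_of_valued_le [CompleteSpace R] {a : ℕ → R} {φ : ℕ → ℤ}
    (hφ : Tendsto φ atTop atTop) (h : ∀ n, Valued.v (a n) ≤ WithZero.exp (-φ n)) : Summable a := by
  refine NonarchimedeanAddGroup.summable_of_tendsto_cofinite_zero ?_
  rw [Nat.cofinite_eq_atTop]
  exact tendsto_zero_of_valued_le hφ h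

end Valued

theorem tendsto_pow_sub_mul_atTop {q : ℕ} (hq : 1 < q) (c : ℕ) :
    Tendsto (fun i : ℕ => (q : ℤ) ^ i - c * i) atTop atTop := by
  rw [← tendsto_intCast_atTop_iff (R := ℝ)]
  push_cast
  have hq' : (1 : ℝ) < q := by exact_mod_cast hq
  exact (Asymptotics.IsEquivalent.refl.sub_isLittleO
    ((isLittleO_coe_const_pow_of_one_lt hq').const_mul_left (c : ℝ))).symm.tendsto_atTop
    (tendsto_pow_atTop_atTop_of_one_lt hq')

/-! ### The `v`-adic valuation -/

section val

/-- The embedding of `A` into `k`. -/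
abbrev toK (F : Type*) [Field F] : F[X] →+* RatFunc F := algebraMap F[X] (RatFunc F)

variable {F : Type*} [Field F] (v : F[X]) (hv : Irreducible v)

/-- The `v`-adic valuation of `k`. -/
abbrev val : Valuation (RatFunc F) (WithZero (Multiplicative ℤ)) :=
  (place v hv).valuation (RatFunc F)

/-- The embedding of `k` into `k_v`. -/
abbrev toKv : RatFunc F →+* Kv v hv := algebraMap (RatFunc F) (Kv v hv)

theorem valued_toKv (x : RatFunc F) : Valued.v (toKv v hv x) = val v hv x :=
  (place v hv).valuedAdicCompletion_eq_valuation' x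

theorem val_toK_le_one (a : F[X]) : val v hv (toK F a) ≤ 1 := (place v hv).valuation_le_one a

theorem val_smul_le (a : F[X]) (x : RatFunc F) : val v hv (a • x) ≤ val v hv x := by
  rw [Algebra.smul_def, map_mul]
  exact mul_le_of_le_one_left' (val_toK_le_one v hv a)

theorem val_toK_le_exp_iff (a : F[X]) (n : ℕ) :
    val v hv (toK F a) ≤ WithZero.exp (-(n : ℤ)) ↔ v ^ n ∣ a := by
  rw [HeightOneSpectrum.valuation_of_algebraMap, HeightOneSpectrum.intValuation_le_pow_iff_mem,
    show (place v hv).asIdeal = Ideal.span {v} from rfl, Ideal.span_singleton_pow,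
    Ideal.mem_span_singleton]

theorem val_toK_lt_one_iff (a : F[X]) : val v hv (toK F a) < 1 ↔ v ∣ a := by
  rw [HeightOneSpectrum.valuation_lt_one_iff_mem,
    show (place v hv).asIdeal = Ideal.span {v} from rfl, Ideal.mem_span_singleton]

theorem val_toK_inv_le {a : F[X]} (ha : a ≠ 0) {n : ℕ} (h : ¬ v ^ (n + 1) ∣ a) :
    val v hv (toK F a)⁻¹ ≤ WithZero.exp (n : ℤ) := by
  have h0 : val v hv (toK F a) ≠ 0 := by simpa using ha
  rw [← val_toK_le_exp_iff v hv, not_le, ← WithZero.exp_log h0, WithZero.exp_lt_exp] at h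
  rw [map_inv₀, ← WithZero.exp_log h0, ← WithZero.exp_neg, WithZero.exp_le_exp]
  push_cast at h
  omega

variable [Fintype F]

theorem val_lam_inv_le {i : ℕ} (hi : i ≠ 0) :
    val v hv (toK F (lam F i))⁻¹ ≤
      WithZero.exp (((if v.natDegree ∣ i then 1 else 0 : ℕ) : ℤ)) := by
  refine val_toK_inv_le v hv (lam_ne_zero hi) ?_
  split_ifs with h
  · exact not_sq_dvd_lam hv hi
  · rw [zero_add, pow_one]
    exact fun h' => h (natDegree_dvd_of_dvd_lam hv h')

theorem val_lamProd_inv_le (i : ℕ) :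
    val v hv (toK F (lamProd F i))⁻¹ ≤ WithZero.exp ((i / v.natDegree : ℕ) : ℤ) := by
  induction i with
  | zero => simp [lamProd_zero]
  | succ i ih =>
    rw [lamProd_succ, map_mul, mul_inv, map_mul, Nat.succ_div, Nat.cast_add, WithZero.exp_add]
    exact mul_le_mul' ih (val_lam_inv_le v hv i.succ_ne_zero)

end val

/-! ### Truncated star sums -/

section StarSum

section sumOp

variable {R : Type*} [CommRing R]

/-- The summation operator `g ↦ (n ↦ ∑_{i < n} f_i g_(i+1))` from which nested sums with weakly
decreasing indices are built. -/
def sumOp (f : ℕ → R) : (ℕ → R) →ₗ[R] (ℕ → R) where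
  toFun g n := ∑ i ∈ Finset.range n, f i * g (i + 1)
  map_add' g h := by
    ext n
    simp [mul_add, Finset.sum_add_distrib]
  map_smul' c g := by
    ext n
    simp [Finset.mul_sum, mul_left_comm]

theorem sumOp_apply (f g : ℕ → R) (n : ℕ) :
    sumOp f g n = ∑ i ∈ Finset.range n, f i * g (i + 1) := rfl

theorem sumOp_zero (f g : ℕ → R) : sumOp f g 0 = 0 := rfl

theorem sumOp_succ (f g : ℕ → R) (n : ℕ) :
    sumOp f g (n + 1) = sumOp f g n + f n * g (n + 1) :=
  Finset.sum_range_succ _ _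

-- The product of two sums over `i` and `i'` is split into `i ≥ i'` and `i' ≥ i`, the diagonal
-- being counted twice.
theorem sumOp_mul_sumOp (f f' g g' : ℕ → R) :
    sumOp f g * sumOp f' g' =
      sumOp f (g * sumOp f' g') + sumOp f' (sumOp f g * g') - sumOp (f * f') (g * g') := by
  ext n
  induction n with
  | zero => simp [sumOp_zero]
  | succ n ih =>
    simp only [Pi.mul_apply, Pi.sub_apply, Pi.add_apply, sumOp_succ] at ih ⊢
    linear_combination ih

end sumOp

variable {F : Type*} [Field F]

/-- The weight of a list of letters `(s, u)`. -/
def weight (c : List (ℕ+ × F[X])) : ℕ := (c.map fun x => (x.1 : ℕ)).sum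

theorem weight_nil : weight ([] : List (ℕ+ × F[X])) = 0 := rfl

theorem weight_cons (x : ℕ+ × F[X]) (c : List (ℕ+ × F[X])) : weight (x :: c) = x.1 + weight c :=
  List.sum_cons

variable [Fintype F]

/-- The sequence `u^(q^i) / L_i^s` attached to the letter `x = (s, u)`. -/
def term (x : ℕ+ × F[X]) (i : ℕ) : RatFunc F :=
  toK F x.2 ^ Fintype.card F ^ i * (toK F (lamProd F i))⁻¹ ^ (x.1 : ℕ)

/-- The star sum `∑_{n > i_1 ≥ i_2 ≥ ⋯} ∏ u_j^(q^(i_j)) / L_(i_j)^(s_j)`, as a function of `n`. -/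
def starSum : List (ℕ+ × F[X]) → ℕ → RatFunc F
  | [] => 1
  | x :: c => sumOp (term x) (starSum c)

theorem term_mul_term (x y : ℕ+ × F[X]) : term x * term y = term (x.1 + y.1, x.2 * y.2) := by
  ext i
  simp only [term, Pi.mul_apply, PNat.add_coe, map_mul, mul_pow, pow_add]
  ring

theorem starSum_cons_mul_starSum_cons (x y : ℕ+ × F[X]) (a b : List (ℕ+ × F[X])) :
    starSum (x :: a) * starSum (y :: b) =
      sumOp (term x) (starSum a * starSum (y :: b)) +
        sumOp (term y) (starSum (x :: a) * starSum b) -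
        sumOp (term (x.1 + y.1, x.2 * y.2)) (starSum a * starSum b) := by
  rw [← term_mul_term]
  exact sumOp_mul_sumOp _ _ _ _

/-- The `A`-span of the star sums of weight `w`. -/
def starSpan (F : Type*) [Field F] [Fintype F] (w : ℕ) : Submodule F[X] (ℕ → RatFunc F) :=
  Submodule.span F[X] {g | ∃ c : List (ℕ+ × F[X]), weight c = w ∧ starSum c = g}

/-- The `A`-span of the star sums of weight `w` whose first argument is divisible by `v`. Its
elements converge `v`-adically; coefficients are kept in `A` so that their limits have bounded
denominators. -/
def smallStarSpan (v : F[X]) (w : ℕ) : Submodule F[X] (ℕ → RatFunc F) :=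
  Submodule.span F[X] {g | ∃ (x : ℕ+ × F[X]) (c : List (ℕ+ × F[X])),
    v ∣ x.2 ∧ weight (x :: c) = w ∧ starSum (x :: c) = g}

variable {v : F[X]} {x y : ℕ+ × F[X]} {w w' : ℕ} {g : ℕ → RatFunc F}

theorem starSum_mem_starSpan (c : List (ℕ+ × F[X])) (h : weight c = w) : starSum c ∈ starSpan F w :=
  Submodule.subset_span ⟨c, h, rfl⟩

theorem starSum_mem_smallStarSpan (hx : v ∣ x.2) (c : List (ℕ+ × F[X])) (h : weight (x :: c) = w) :
    starSum (x :: c) ∈ smallStarSpan v w :=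
  Submodule.subset_span ⟨x, c, hx, h, rfl⟩

theorem sumOp_term_mem_starSpan (x : ℕ+ × F[X]) (hg : g ∈ starSpan F w) (hw : x.1 + w = w') :
    sumOp (term x) g ∈ starSpan F w' := by
  refine (Submodule.map_span_le ((sumOp (term x)).restrictScalars F[X]) _ _).2 ?_
    (Submodule.mem_map_of_mem hg)
  rintro _ ⟨c, hc, rfl⟩
  exact starSum_mem_starSpan (x :: c) (by rw [← hw, ← hc, weight_cons])

theorem sumOp_term_mem_smallStarSpan (hx : v ∣ x.2) (hg : g ∈ starSpan F w) (hw : x.1 + w = w') :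
    sumOp (term x) g ∈ smallStarSpan v w' := by
  refine (Submodule.map_span_le ((sumOp (term x)).restrictScalars F[X]) _ _).2 ?_
    (Submodule.mem_map_of_mem hg)
  rintro _ ⟨c, hc, rfl⟩
  exact starSum_mem_smallStarSpan hx c (by rw [← hw, ← hc, weight_cons])

theorem starSum_mul_starSum_mem (a b : List (ℕ+ × F[X])) :
    starSum a * starSum b ∈ starSpan F (weight a + weight b) := by
  match a, b with
  | [], b => simpa [starSum, weight_nil] using starSum_mem_starSpan b rfl
  | x :: a, [] => simpa [starSum, weight_nil] using starSum_mem_starSpan (x :: a) rfl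
  | x :: a, y :: b =>
    rw [starSum_cons_mul_starSum_cons]
    simp only [weight_cons]
    refine sub_mem (add_mem ?_ ?_) ?_
    · exact sumOp_term_mem_starSpan x (starSum_mul_starSum_mem a (y :: b))
        (by rw [weight_cons]; ring)
    · exact sumOp_term_mem_starSpan y (starSum_mul_starSum_mem (x :: a) b)
        (by rw [weight_cons]; ring)
    · exact sumOp_term_mem_starSpan _ (starSum_mul_starSum_mem a b) (by rw [PNat.add_coe]; ring)
termination_by a.length + b.length

theorem starSum_mul_starSum_mem_smallStarSpan (hx : v ∣ x.2) (hy : v ∣ y.2)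
    (a b : List (ℕ+ × F[X])) :
    starSum (x :: a) * starSum (y :: b) ∈
      smallStarSpan v (weight (x :: a) + weight (y :: b)) := by
  rw [starSum_cons_mul_starSum_cons]
  refine sub_mem (add_mem ?_ ?_) ?_
  · exact sumOp_term_mem_smallStarSpan hx (starSum_mul_starSum_mem a (y :: b))
      (by rw [weight_cons, weight_cons]; ring)
  · exact sumOp_term_mem_smallStarSpan hy (starSum_mul_starSum_mem (x :: a) b)
      (by rw [weight_cons, weight_cons]; ring)
  · exact sumOp_term_mem_smallStarSpan (hx.mul_right _) (starSum_mul_starSum_mem a b)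
      (by rw [weight_cons, weight_cons, PNat.add_coe]; ring)

end StarSum

/-! ### Growth of star sums -/

section Growth

variable {F : Type*} [Field F] [Fintype F] (v : F[X]) (hv : Irreducible v)
variable {w : ℕ} {g : ℕ → RatFunc F}

theorem val_term_le {x : ℕ+ × F[X]} {m : ℕ} (hx : v ^ m ∣ x.2) (i : ℕ) :
    val v hv (term x i) ≤
      WithZero.exp ((x.1 : ℤ) * (i / v.natDegree : ℕ) - m * (Fintype.card F : ℤ) ^ i) := by
  have hu : val v hv (toK F (x.2 ^ Fintype.card F ^ i)) ≤
      WithZero.exp (-((m * Fintype.card F ^ i : ℕ) : ℤ)) :=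
    (val_toK_le_exp_iff v hv _ _).2 (pow_mul v m _ ▸ pow_dvd_pow_of_dvd hx _)
  rw [term, map_mul, map_pow _ _ (x.1 : ℕ), ← map_pow (toK F)]
  refine (mul_le_mul' hu (pow_le_pow_left' (val_lamProd_inv_le v hv i) _)).trans_eq ?_
  rw [← WithZero.exp_nsmul, ← WithZero.exp_add, nsmul_eq_mul, neg_add_eq_sub]
  push_cast
  rfl

theorem val_starSum_succ_le (c : List (ℕ+ × F[X])) (n : ℕ) :
    val v hv (starSum c (n + 1)) ≤ WithZero.exp ((weight c : ℤ) * (n / v.natDegree : ℕ)) := by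
  induction c generalizing n with
  | nil => simp [starSum, weight_nil]
  | cons x c ih =>
    rw [starSum, sumOp_apply]
    refine Valuation.map_sum_le (val v hv) fun i hi => ?_
    have hin : i ≤ n := Nat.lt_succ_iff.1 (Finset.mem_range.1 hi)
    have hx : v ^ 0 ∣ x.2 := by simp
    rw [map_mul]
    refine (mul_le_mul' (val_term_le v hv hx i) (ih i)).trans ?_
    rw [← WithZero.exp_add, WithZero.exp_le_exp, Nat.cast_zero, zero_mul, sub_zero, ← add_mul,
      weight_cons, Nat.cast_add]
    gcongr

/-- A lower bound for the order of the `i`-th increment of a star sum of weight `w` whose first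
argument is divisible by `v`. -/
def growth (w i : ℕ) : ℤ := (Fintype.card F : ℤ) ^ i - w * (i / v.natDegree : ℕ)

theorem val_sub_le_of_mem_smallStarSpan (hg : g ∈ smallStarSpan v w) (i : ℕ) :
    val v hv (g (i + 1) - g i) ≤ WithZero.exp (-growth v w i) := by
  induction hg using Submodule.span_induction with
  | mem g hg =>
    obtain ⟨x, c, hx, rfl, rfl⟩ := hg
    have hx' : v ^ 1 ∣ x.2 := by rwa [pow_one]
    rw [starSum, sumOp_succ, add_sub_cancel_left, map_mul]
    refine (mul_le_mul' (val_term_le v hv hx' i) (val_starSum_succ_le v hv c i)).trans_eq ?_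
    rw [← WithZero.exp_add, growth, weight_cons]
    congr 1
    push_cast
    ring
  | zero => simp
  | add g h _ _ hg hh =>
    rw [Pi.add_apply, Pi.add_apply, add_sub_add_comm]
    exact Valuation.map_add_le _ hg hh
  | smul a g _ hg =>
    rw [Pi.smul_apply, Pi.smul_apply, ← smul_sub]
    exact (val_smul_le v hv _ _).trans hg

theorem apply_zero_of_mem_smallStarSpan (hg : g ∈ smallStarSpan v w) : g 0 = 0 := by
  have hle : smallStarSpan v w ≤ LinearMap.ker (LinearMap.proj (R := F[X]) 0) := by
    refine Submodule.span_le.2 ?_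
    rintro _ ⟨x, c, -, -, rfl⟩
    exact sumOp_zero (term x) (starSum c)
  exact hle hg

theorem tendsto_growth (w : ℕ) : Tendsto (growth v w) atTop atTop := by
  refine tendsto_atTop_mono (fun i => ?_)
    (tendsto_pow_sub_mul_atTop (Fintype.one_lt_card (α := F)) w)
  rw [growth]
  gcongr
  exact Nat.div_le_self _ _

variable {v}

include hv in
theorem B_le_growth (w i : ℕ) : B v w ≤ growth v w i := by
  refine ((B_isLeast hv w).2 ⟨i / v.natDegree, rfl⟩).trans ?_
  beta_reduce
  rw [growth, qv, Nat.cast_pow, ← pow_mul, mul_comm (w : ℤ)]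
  gcongr
  · exact_mod_cast Fintype.card_pos
  · exact Nat.mul_div_le _ _

theorem exists_tendsto_of_mem_smallStarSpan (hg : g ∈ smallStarSpan v w) :
    ∃ x, Tendsto (fun n => toKv v hv (g n)) atTop (𝓝 x) ∧
      Valued.v x ≤ WithZero.exp (-B v w) := by
  have hincr (i : ℕ) :
      Valued.v (toKv v hv (g (i + 1) - g i)) ≤ WithZero.exp (-growth v w i) := by
    rw [valued_toKv]
    exact val_sub_le_of_mem_smallStarSpan v hv hg i
  have htele (n : ℕ) : ∑ i ∈ Finset.range n, toKv v hv (g (i + 1) - g i) = toKv v hv (g n) := by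
    rw [← map_sum, Finset.sum_range_sub, apply_zero_of_mem_smallStarSpan v hg, sub_zero]
  obtain ⟨x, hx⟩ := summable_of_valued_le (tendsto_growth v w) hincr
  have hlim := hx.tendsto_sum_nat
  simp only [htele] at hlim
  refine ⟨x, hlim, valued_le_of_tendsto hlim fun n => ?_⟩
  rw [← htele]
  refine Valuation.map_sum_le _ fun i _ => (hincr i).trans ?_
  exact WithZero.exp_le_exp.2 (neg_le_neg (B_le_growth hv w i))

end Growth

/-! ### Composition of `τ`-series -/

section TauSeries

theorem sum_antidiagonal_eq_fst_zero {M : Type*} [AddCommMonoid M] {f : ℕ × ℕ → M}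
    (hf : ∀ i j, f (i + 1, j) = 0) (n : ℕ) :
    ∑ ij ∈ Finset.HasAntidiagonal.antidiagonal n, f ij = f (0, n) := by
  cases n with
  | zero => simp
  | succ n => simp [Finset.Nat.sum_antidiagonal_succ, hf]

theorem sum_antidiagonal_eq_snd_zero {M : Type*} [AddCommMonoid M] {f : ℕ × ℕ → M}
    (hf : ∀ i j, f (i, j + 1) = 0) (n : ℕ) :
    ∑ ij ∈ Finset.HasAntidiagonal.antidiagonal n, f ij = f (n, 0) := by
  cases n with
  | zero => simp
  | succ n => simp [Finset.Nat.sum_antidiagonal_succ', hf]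

variable {F : Type*} [Field F] [Fintype F]

/-- The endomorphism `x ↦ x^(q^i)` of `k`. -/
def frob (F : Type*) [Field F] [Fintype F] (i : ℕ) : RatFunc F →+* RatFunc F :=
  ((FiniteField.frobeniusAlgHom F (RatFunc F)) ^ i : RatFunc F →ₐ[F] RatFunc F)

theorem frob_apply (i : ℕ) (x : RatFunc F) : frob F i x = x ^ Fintype.card F ^ i := by
  change ((FiniteField.frobeniusAlgHom F (RatFunc F)) ^ i) x = _
  rw [AlgHom.coe_pow, FiniteField.coe_frobeniusAlgHom, pow_iterate]

theorem coe_frob (i : ℕ) : ⇑(frob F i) = fun x => x ^ Fintype.card F ^ i := funext (frob_apply i)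

theorem frob_zero : frob F 0 = RingHom.id _ := by
  ext x
  simp [frob_apply]

theorem frob_frob (i j : ℕ) (x : RatFunc F) : frob F i (frob F j x) = frob F (i + j) x := by
  simp only [frob_apply, ← pow_mul, pow_add, mul_comm]

variable {ι : Type*}

theorem map_frob_zero (M : Matrix ι ι (RatFunc F)) : M.map (frob F 0) = M := by
  rw [frob_zero]
  exact M.map_id

theorem map_frob_map_frob (M : Matrix ι ι (RatFunc F)) (i j : ℕ) :
    (M.map (frob F j)).map (frob F i) = M.map (frob F (i + j)) := by
  ext a b
  exact frob_frob i j _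

variable [Fintype ι]

namespace TauSeries

theorem comp_apply (P Q : TauSeries F ι) (n : ℕ) :
    P.comp Q n =
      ∑ ij ∈ Finset.HasAntidiagonal.antidiagonal n, P ij.1 * (Q ij.2).map (frob F ij.1) := by
  simp only [comp, coe_frob]

theorem comp_zero (P Q : TauSeries F ι) : P.comp Q 0 = P 0 * Q 0 := by
  simp [comp_apply, map_frob_zero]

theorem comp_assoc (P Q R : TauSeries F ι) : (P.comp Q).comp R = P.comp (Q.comp R) := by
  classical
  ext1 n
  have map_comp (i m : ℕ) : (Q.comp R m).map (frob F i) =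
      ∑ x ∈ Finset.HasAntidiagonal.antidiagonal m,
        (Q x.1).map (frob F i) * (R x.2).map (frob F (i + x.1)) := by
    rw [comp_apply, ← RingHom.mapMatrix_apply, map_sum]
    simp only [map_mul, RingHom.mapMatrix_apply, map_frob_map_frob]
  simp only [comp_apply (P.comp Q), comp_apply P (Q.comp R), map_comp, comp_apply P Q,
    Finset.sum_mul, Finset.mul_sum, Finset.sum_sigma']
  refine Finset.sum_nbij' (fun x => ⟨(x.2.1, x.2.2 + x.1.2), (x.2.2, x.1.2)⟩)
    (fun x => ⟨(x.1.1 + x.2.1, x.2.2), (x.1.1, x.2.1)⟩) ?_ ?_ ?_ ?_ ?_ <;>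
  · rintro ⟨⟨a, b⟩, ⟨c, d⟩⟩ hx
    simp only [Finset.mem_sigma, Finset.HasAntidiagonal.mem_antidiagonal] at hx
    obtain ⟨rfl, rfl⟩ := hx
    simp [add_assoc, mul_assoc]

theorem comp_const (P : TauSeries F ι) (M : Matrix ι ι F[X]) (n : ℕ) :
    P.comp (const M) n = P n * (M.map (toK F)).map (frob F n) := by
  rw [comp_apply, sum_antidiagonal_eq_snd_zero]
  · rfl
  · simp [const]

theorem const_comp (P : TauSeries F ι) (M : Matrix ι ι F[X]) (n : ℕ) :
    (const M).comp P n = M.map (toK F) * P n := by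
  rw [comp_apply, sum_antidiagonal_eq_fst_zero]
  · simp only [const, map_frob_zero]
  · simp [const]

variable [DecidableEq ι]

theorem comp_one (P : TauSeries F ι) : P.comp (const 1) = P := by
  ext1 n
  simp [comp_const]

theorem one_comp (P : TauSeries F ι) : (const 1 : TauSeries F ι).comp P = P := by
  ext1 n
  simp [const_comp]

end TauSeries

end TauSeries

/-! ### Recursions with a nilpotent commutator -/

section Sylvester

attribute [local instance] LieRing.ofAssociativeRing

variable {K A : Type*} [Field K] [Ring A] [Algebra K A] {N : A}

theorem bijective_smul_add_lie (hN : IsNilpotent N) {c : K} (hc : c ≠ 0) :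
    Function.Bijective fun R : A => c • R + ⁅N, R⁆ := by
  have hunit : IsUnit (algebraMap K (Module.End K A) c + LieAlgebra.ad K A N) :=
    (LieAlgebra.ad_nilpotent_of_nilpotent (R := K) hN).isUnit_add_left_of_commute
      ((IsUnit.mk0 c hc).map _) (Algebra.commutes _ _).symm
  exact (Module.End.isUnit_iff _).1 hunit

theorem existsUnique_seq_smul_add_lie (hN : IsNilpotent N) {c : ℕ → K} (hc : ∀ n, c n ≠ 0)
    (R₀ : A) (f : ℕ → A → A) :
    ∃! R : ℕ → A, R 0 = R₀ ∧ ∀ n, c n • R (n + 1) + ⁅N, R (n + 1)⁆ = f n (R n) := by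
  have hbij (n : ℕ) := bijective_smul_add_lie hN (hc n)
  choose g hg using fun n => (hbij n).2
  refine ⟨fun n => Nat.rec R₀ (fun n R => g n (f n R)) n, ⟨rfl, fun n => hg n _⟩, ?_⟩
  rintro R ⟨h0, hR⟩
  ext1 n
  induction n with
  | zero => exact h0
  | succ n ih => exact (hbij n).1 ((hR n).trans (by rw [ih]; exact (hg n _).symm))

end Sylvester

/-! ### Existence and uniqueness of the logarithm -/

section Log

attribute [local instance] LieRing.ofAssociativeRing

variable {F : Type*} [Field F] {r : ℕ} (s : Fin (r + 1) → ℕ+) (u : Fin (r + 1) → F[X])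

/-- `N` over `k`. -/
abbrev matNK (F : Type*) [Field F] {r : ℕ} (s : Fin (r + 1) → ℕ+) :
    Matrix (Idx s) (Idx s) (RatFunc F) := (matN F s).map (toK F)

/-- `E` over `k`. -/
abbrev matEK : Matrix (Idx s) (Idx s) (RatFunc F) := (matE s u).map (toK F)

theorem snd_eq_add_of_matN_pow_ne_zero {m : ℕ} {x y : Idx s} (h : (matN F s ^ m) x y ≠ 0) :
    (y.2 : ℕ) = x.2 + m := by
  induction m generalizing y with
  | zero =>
    rw [pow_zero, Matrix.one_apply, ne_eq, ite_eq_right_iff, Classical.not_imp] at h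
    rw [h.1, add_zero]
  | succ m ih =>
    rw [pow_succ, Matrix.mul_apply] at h
    obtain ⟨z, -, hz⟩ := Finset.exists_ne_zero_of_sum_ne_zero h
    have hxz := ih (left_ne_zero_of_mul hz)
    have hzy := right_ne_zero_of_mul hz
    rw [matN, Matrix.of_apply, ne_eq, ite_eq_right_iff, Classical.not_imp] at hzy
    omega

theorem isNilpotent_matN : IsNilpotent (matN F s) := by
  refine ⟨∑ l, blockSize s l, Matrix.ext fun x y => ?_⟩
  by_contra hxy
  have hy : (y.2 : ℕ) = x.2 + ∑ l, blockSize s l := snd_eq_add_of_matN_pow_ne_zero s hxy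
  have hle : blockSize s y.1 ≤ ∑ l, blockSize s l :=
    Finset.single_le_sum (fun _ _ => Nat.zero_le _) (Finset.mem_univ y.1)
  exact absurd y.2.isLt (by omega)

theorem isNilpotent_matNK : IsNilpotent (matNK F s) :=
  (isNilpotent_matN s).map (toK F).mapMatrix

theorem map_dRho : (dRho F s).map (toK F) = (RatFunc.X : RatFunc F) • 1 + matNK F s := by
  ext x y
  simp [dRho, Matrix.one_apply, apply_ite (toK F)]

variable [Fintype F]

theorem toK_lam (i : ℕ) : toK F (lam F i) = RatFunc.X - RatFunc.X ^ Fintype.card F ^ i := by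
  simp [lam]

theorem toK_lam_ne_zero {i : ℕ} (hi : i ≠ 0) : toK F (lam F i) ≠ 0 := by
  simpa using lam_ne_zero hi

theorem map_frob_matNK (i : ℕ) : (matNK F s).map (frob F i) = matNK F s := by
  ext x y
  simp only [Matrix.map_apply, matN, Matrix.of_apply]
  split_ifs <;> simp

theorem map_frob_dRho (i : ℕ) : ((dRho F s).map (toK F)).map (frob F i) =
    (RatFunc.X ^ Fintype.card F ^ i : RatFunc F) • 1 + matNK F s := by
  rw [map_dRho]
  conv_rhs => rw [← map_frob_matNK s i]
  ext x y
  simp only [Matrix.map_apply, Matrix.add_apply, Matrix.smul_apply, smul_eq_mul, map_add, map_mul,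
    Matrix.one_apply, apply_ite (frob F i), map_one, map_zero, ← frob_apply]

theorem dRho_mul_sub_mul_dRho (R : Matrix (Idx s) (Idx s) (RatFunc F)) (i : ℕ) :
    (dRho F s).map (toK F) * R - R * ((dRho F s).map (toK F)).map (frob F i) =
      toK F (lam F i) • R + ⁅matNK F s, R⁆ := by
  rw [map_frob_dRho, map_dRho, toK_lam, Ring.lie_def, add_mul, mul_add, smul_mul_assoc, one_mul,
    mul_smul_comm, mul_one, sub_smul]
  abel

theorem existsUnique_tauSeries (f : ℕ → Matrix (Idx s) (Idx s) (RatFunc F) →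
    Matrix (Idx s) (Idx s) (RatFunc F)) :
    ∃! R : TauSeries F (Idx s), R 0 = 1 ∧ ∀ n,
      toK F (lam F (n + 1)) • R (n + 1) + ⁅matNK F s, R (n + 1)⁆ = f n (R n) :=
  existsUnique_seq_smul_add_lie (isNilpotent_matNK s) (fun n => toK_lam_ne_zero n.succ_ne_zero) 1 f

theorem rhoSeries_comp_succ (Q : TauSeries F (Idx s)) (n : ℕ) :
    (rhoSeries s u).comp Q (n + 1) =
      (dRho F s).map (toK F) * Q (n + 1) + matEK s u * (Q n).map (frob F 1) := by
  rw [TauSeries.comp_apply, Finset.Nat.sum_antidiagonal_succ, sum_antidiagonal_eq_fst_zero]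
  · simp only [rhoSeries, map_frob_zero]
  · simp [rhoSeries]

theorem comp_rhoSeries_succ (P : TauSeries F (Idx s)) (n : ℕ) :
    P.comp (rhoSeries s u) (n + 1) =
      P (n + 1) * ((dRho F s).map (toK F)).map (frob F (n + 1)) +
        P n * (matEK s u).map (frob F n) := by
  rw [TauSeries.comp_apply, Finset.Nat.sum_antidiagonal_succ', sum_antidiagonal_eq_snd_zero]
  · rfl
  · simp [rhoSeries]

/-- The functional equation `∂ρ_t ∘ P = P ∘ ρ_t` of the logarithm with `P = 1 + ⋯`,
coefficientwise. -/
def LogRec (P : TauSeries F (Idx s)) : Prop :=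
  P 0 = 1 ∧ ∀ n, toK F (lam F (n + 1)) • P (n + 1) + ⁅matNK F s, P (n + 1)⁆ =
    P n * (matEK s u).map (frob F n)

variable {s u}

theorem dRho_comp_eq_iff_logRec {P : TauSeries F (Idx s)} (h0 : P 0 = 1) :
    (TauSeries.const (dRho F s)).comp P = P.comp (rhoSeries s u) ↔ LogRec s u P := by
  have hsucc (n : ℕ) :
      (TauSeries.const (dRho F s)).comp P (n + 1) = P.comp (rhoSeries s u) (n + 1) ↔
        toK F (lam F (n + 1)) • P (n + 1) + ⁅matNK F s, P (n + 1)⁆ =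
          P n * (matEK s u).map (frob F n) := by
    rw [TauSeries.const_comp, comp_rhoSeries_succ, ← dRho_mul_sub_mul_dRho, sub_eq_iff_eq_add']
  refine ⟨fun h => ⟨h0, fun n => (hsucc n).1 (congrFun h _)⟩, fun h => funext fun n => ?_⟩
  obtain _ | n := n
  · simp [TauSeries.comp_zero, h0, TauSeries.const, rhoSeries]
  · exact (hsucc n).2 (h.2 n)

theorem isExp_iff {Q : TauSeries F (Idx s)} :
    IsExp s u Q ↔ Q 0 = 1 ∧ ∀ n, toK F (lam F (n + 1)) • Q (n + 1) + ⁅matNK F s, Q (n + 1)⁆ =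
      -(matEK s u * (Q n).map (frob F 1)) := by
  refine and_congr_right fun h0 => ?_
  have hsucc (n : ℕ) :
      Q.comp (TauSeries.const (dRho F s)) (n + 1) = (rhoSeries s u).comp Q (n + 1) ↔
        toK F (lam F (n + 1)) • Q (n + 1) + ⁅matNK F s, Q (n + 1)⁆ =
          -(matEK s u * (Q n).map (frob F 1)) := by
    rw [TauSeries.comp_const, rhoSeries_comp_succ, ← dRho_mul_sub_mul_dRho, sub_eq_iff_eq_add,
      neg_add_eq_sub, eq_sub_iff_add_eq, eq_comm]
  refine ⟨fun h n => (hsucc n).1 (congrFun h _), fun h => funext fun n => ?_⟩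
  obtain _ | n := n
  · simp [TauSeries.comp_zero, h0, TauSeries.const, rhoSeries]
  · exact (hsucc n).2 (h n)

theorem IsLog.logRec {P : TauSeries F (Idx s)} (hP : IsLog s u P) : LogRec s u P := by
  obtain ⟨Q, ⟨hQ0, hQ⟩, hPQ, hQP⟩ := hP
  have h0 : P 0 = 1 := by
    simpa [TauSeries.comp_zero, hQ0, TauSeries.const] using congrFun hPQ 0
  refine (dRho_comp_eq_iff_logRec h0).1 ?_
  calc (TauSeries.const (dRho F s)).comp P
      = (P.comp Q).comp ((TauSeries.const (dRho F s)).comp P) := by rw [hPQ, TauSeries.one_comp]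
    _ = P.comp ((Q.comp (TauSeries.const (dRho F s))).comp P) := by
      simp only [TauSeries.comp_assoc]
    _ = (P.comp (rhoSeries s u)).comp (Q.comp P) := by rw [hQ]; simp only [TauSeries.comp_assoc]
    _ = P.comp (rhoSeries s u) := by rw [hQP, TauSeries.comp_one]

theorem eq_one_of_commute_dRho {R : TauSeries F (Idx s)} (h0 : R 0 = 1)
    (h : (TauSeries.const (dRho F s)).comp R = R.comp (TauSeries.const (dRho F s))) :
    R = TauSeries.const 1 := by
  refine (existsUnique_tauSeries s fun _ _ => 0).unique ⟨h0, fun n => ?_⟩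
    ⟨by simp [TauSeries.const], fun n => by simp [TauSeries.const]⟩
  rw [← dRho_mul_sub_mul_dRho, sub_eq_zero, ← TauSeries.const_comp, h, TauSeries.comp_const]

theorem eq_one_of_commute_rho {R : TauSeries F (Idx s)} (h0 : R 0 = 1)
    (h : (rhoSeries s u).comp R = R.comp (rhoSeries s u)) : R = TauSeries.const 1 := by
  refine (existsUnique_tauSeries s fun n R => R * (matEK s u).map (frob F n) -
    matEK s u * R.map (frob F 1)).unique ⟨h0, fun n => ?_⟩ ⟨by simp [TauSeries.const], fun n => ?_⟩
  · have hn := congrFun h (n + 1)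
    rw [rhoSeries_comp_succ, comp_rhoSeries_succ] at hn
    rw [← dRho_mul_sub_mul_dRho, sub_eq_sub_iff_add_eq_add, hn, add_comm]
  · obtain _ | n := n <;> simp [TauSeries.const, frob_zero]

variable (s u) in
theorem exists_isLog : ∃ P, IsLog s u P := by
  obtain ⟨P, hP, -⟩ := existsUnique_tauSeries s fun n R => R * (matEK s u).map (frob F n)
  obtain ⟨Q, hQ, -⟩ := existsUnique_tauSeries s fun _ R => -(matEK s u * R.map (frob F 1))
  have hQ' := isExp_iff.2 hQ
  have hP' := (dRho_comp_eq_iff_logRec hP.1).2 hP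
  refine ⟨P, Q, hQ', eq_one_of_commute_dRho ?_ ?_, eq_one_of_commute_rho (u := u) ?_ ?_⟩
  · simp [TauSeries.comp_zero, hP.1, hQ.1]
  · rw [← TauSeries.comp_assoc, hP', TauSeries.comp_assoc, ← hQ'.2, TauSeries.comp_assoc]
  · simp [TauSeries.comp_zero, hP.1, hQ.1]
  · rw [← TauSeries.comp_assoc, ← hQ'.2, TauSeries.comp_assoc, hP', TauSeries.comp_assoc]

end Log

/-! ### Convergence of the logarithm -/

section EntryBound

variable {K : Type*} [Field K] (ν : Valuation K (WithZero (Multiplicative ℤ))) {m n o : Type*}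

/-- All entries of the matrix have order at least `-b`. -/
def EntryBound (b : ℤ) (R : Matrix m n K) : Prop := ∀ i j, ν (R i j) ≤ WithZero.exp b

variable {ν} {b c : ℤ} {R S : Matrix m n K}

theorem EntryBound.mono (h : b ≤ c) (hR : EntryBound ν b R) : EntryBound ν c R :=
  fun i j => (hR i j).trans (WithZero.exp_le_exp.2 h)

theorem EntryBound.sub (hR : EntryBound ν b R) (hS : EntryBound ν b S) : EntryBound ν b (R - S) :=
  fun i j => Valuation.map_sub_le _ (hR i j) (hS i j)

theorem EntryBound.mul [Fintype n] {T : Matrix n o K} (hR : EntryBound ν b R)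
    (hT : EntryBound ν c T) : EntryBound ν (b + c) (R * T) := by
  intro i k
  rw [Matrix.mul_apply]
  refine Valuation.map_sum_le ν fun j _ => ?_
  rw [map_mul, WithZero.exp_add]
  exact mul_le_mul' (hR i j) (hT j k)

theorem EntryBound.smul {a : K} (ha : ν a ≤ WithZero.exp c) (hR : EntryBound ν b R) :
    EntryBound ν (c + b) (a • R) := by
  intro i j
  rw [Matrix.smul_apply, smul_eq_mul, map_mul, WithZero.exp_add]
  exact mul_le_mul' ha (hR i j)

theorem EntryBound.one [DecidableEq n] : EntryBound ν 0 (1 : Matrix n n K) := by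
  intro i j
  rw [Matrix.one_apply]
  split_ifs <;> simp

-- `R = a⁻¹ (S - D R)` for `S = a R + D R`, and `D R` solves the same equation for `D S` with a
-- smaller nilpotency exponent.
theorem EntryBound.of_smul_add {D : Module.End K (Matrix m n K)}
    (hD : ∀ {b T}, EntryBound ν b T → EntryBound ν b (D T)) {a : K} (ha0 : a ≠ 0)
    (ha : ν a⁻¹ ≤ WithZero.exp 1) {e : ℕ} (he : (D ^ e) R = 0)
    (h : EntryBound ν b (a • R + D R)) : EntryBound ν (b + e) R := by
  induction e generalizing R with
  | zero =>
    obtain rfl : R = 0 := he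
    intro i j
    simp
  | succ e ih =>
    have hDR : EntryBound ν (b + e) (D R) := by
      refine ih (by rwa [← Module.End.mul_apply, ← pow_succ]) ?_
      rw [← map_smul, ← map_add]
      exact hD h
    have hR : R = a⁻¹ • (a • R + D R - D R) := by
      rw [add_sub_cancel_right, inv_smul_smul₀ ha0]
    rw [hR]
    exact (((h.mono (by omega)).sub hDR).smul ha).mono (by push_cast; omega)

end EntryBound

section LogConvergence

attribute [local instance] LieRing.ofAssociativeRing

variable {F : Type*} [Field F] {v : F[X]} {hv : Irreducible v}

theorem entryBound_map {ι : Type*} (M : Matrix ι ι F[X]) :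
    EntryBound (val v hv) 0 (M.map (toK F)) :=
  fun _ _ => val_toK_le_one v hv _

variable {r : ℕ} {s : Fin (r + 1) → ℕ+}

theorem EntryBound.lie_matNK {b : ℤ} {T : Matrix (Idx s) (Idx s) (RatFunc F)}
    (hT : EntryBound (val v hv) b T) : EntryBound (val v hv) b ⁅matNK F s, T⁆ := by
  have hN : EntryBound (val v hv) 0 (matNK F s) := entryBound_map _
  rw [Ring.lie_def]
  exact ((hN.mul hT).mono (zero_add b).le).sub ((hT.mul hN).mono (add_zero b).le)

variable [Fintype F]

theorem entryBound_map_frob {ι : Type*} (M : Matrix ι ι F[X]) (i : ℕ) :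
    EntryBound (val v hv) 0 ((M.map (toK F)).map (frob F i)) := by
  intro x y
  rw [Matrix.map_apply, Matrix.map_apply, frob_apply, ← map_pow]
  exact val_toK_le_one v hv _

variable {u : Fin (r + 1) → F[X]}

theorem LogRec.exists_entryBound {P : TauSeries F (Idx s)} (hP : LogRec s u P) :
    ∃ C : ℕ, ∀ n : ℕ, EntryBound (val v hv) (C * n) (P n) := by
  obtain ⟨e, he⟩ := LieAlgebra.ad_nilpotent_of_nilpotent (R := RatFunc F)
    (isNilpotent_matNK (F := F) s)
  refine ⟨e, fun n => ?_⟩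
  induction n with
  | zero =>
    rw [hP.1, Nat.cast_zero, mul_zero]
    exact EntryBound.one
  | succ n ih =>
    have hlam : val v hv (toK F (lam F (n + 1)))⁻¹ ≤ WithZero.exp 1 := by
      refine (val_lam_inv_le v hv n.succ_ne_zero).trans (WithZero.exp_le_exp.2 ?_)
      split_ifs <;> simp
    have hrhs := ih.mul (entryBound_map_frob (v := v) (hv := hv) (matE s u) n)
    rw [← hP.2 n] at hrhs
    refine (EntryBound.of_smul_add (D := LieAlgebra.ad (RatFunc F) _ (matNK F s))
      EntryBound.lie_matNK (toK_lam_ne_zero n.succ_ne_zero) hlam (by rw [he]; rfl) hrhs).mono ?_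
    push_cast
    linarith

variable (v hv s u) in
theorem exists_isLogValue {z : Idx s → F[X]} (hz : ∀ c, v ∣ z c) :
    ∃ y, IsLogValue v hv s u z y := by
  obtain ⟨P, hP⟩ := exists_isLog s u
  obtain ⟨C, hC⟩ := hP.logRec.exists_entryBound (v := v) (hv := hv)
  have hsum : Summable (fun (i : ℕ) (c : Idx s) => toKv v hv
      ((P i *ᵥ fun b => toK F (z b) ^ Fintype.card F ^ i) c)) := by
    refine Pi.summable.2 fun c => summable_of_valued_le
      (tendsto_pow_sub_mul_atTop (Fintype.one_lt_card (α := F)) C) fun i => ?_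
    rw [valued_toKv]
    refine Valuation.map_sum_le (val v hv) fun b _ => ?_
    have hzb : val v hv (toK F (z b ^ Fintype.card F ^ i)) ≤
        WithZero.exp (-((Fintype.card F ^ i : ℕ) : ℤ)) :=
      (val_toK_le_exp_iff v hv _ _).2 (pow_dvd_pow_of_dvd (hz b) _)
    beta_reduce
    rw [map_mul, ← map_pow (toK F), neg_sub, sub_eq_add_neg, WithZero.exp_add]
    exact_mod_cast mul_le_mul' (hC i c b) hzb
  exact hsum.imp fun y hy => ⟨P, hP, hy⟩

end LogConvergence

/-! ### The row of the logarithm that defines the polylogarithms -/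

section Word

/-- The word `[x (m - 1), …, x 0]`. -/
def word {α : Type*} (x : ℕ → α) : ℕ → List α
  | 0 => []
  | m + 1 => x m :: word x m

variable {F : Type*} [Field F]

theorem weight_word (x : ℕ → ℕ+ × F[X]) (m : ℕ) :
    weight (word x m) = ∑ e ∈ Finset.range m, ((x e).1 : ℕ) := by
  induction m with
  | zero => rfl
  | succ m ih => rw [word, weight_cons, ih, Finset.sum_range_succ, add_comm]

variable [Fintype F]

theorem starSum_word_zero (x : ℕ → ℕ+ × F[X]) (m : ℕ) :
    starSum (word x m) 0 = if m = 0 then 1 else 0 := by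
  obtain _ | m := m
  · rfl
  · exact sumOp_zero _ _

theorem starSum_word_succ (x : ℕ → ℕ+ × F[X]) (m n : ℕ) :
    starSum (word x m) (n + 1) =
      ∑ l ∈ Finset.Iic m, starSum (word x l) n * ∏ e ∈ Finset.Ico l m, term (x e) n := by
  simp only [← Nat.range_succ_eq_Iic]
  induction m with
  | zero => simp [word, starSum]
  | succ m ih =>
    rw [word, starSum, sumOp_succ, ih, Finset.sum_range_succ _ (m + 1), Finset.mul_sum, add_comm]
    congr 1
    · refine Finset.sum_congr rfl fun l hl => ?_
      rw [Finset.prod_Ico_succ_top (Finset.mem_range_succ_iff.1 hl)]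
      ring
    · simp [word, starSum]

theorem prod_term (x : ℕ → ℕ+ × F[X]) (t : Finset ℕ) (n : ℕ) :
    ∏ e ∈ t, term (x e) n = toK F (∏ e ∈ t, (x e).2) ^ Fintype.card F ^ n *
      (toK F (lamProd F n))⁻¹ ^ (∑ e ∈ t, ((x e).1 : ℕ)) := by
  simp only [term, Finset.prod_mul_distrib, map_prod, Finset.prod_pow, Finset.prod_pow_eq_pow_sum]

end Word

section Letter

variable {F : Type*} [Field F] {r : ℕ} (s : Fin (r + 1) → ℕ+) (u : Fin (r + 1) → F[X])

/-- The letters `(s_e, u_e)`, extended to all `e : ℕ` by a default letter. -/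
def letter (e : ℕ) : ℕ+ × F[X] :=
  if h : e < r + 1 then (s ⟨e, h⟩, u ⟨e, h⟩) else (1, 0)

theorem letter_val (e : Fin (r + 1)) : letter s u e = (s e, u e) := dif_pos e.isLt

@[to_additive]
theorem prod_map_letter {M : Type*} [CommMonoid M] (f : ℕ+ × F[X] → M) (t : Finset (Fin (r + 1))) :
    ∏ e ∈ t.map Fin.valEmbedding, f (letter s u e) = ∏ e ∈ t, f (s e, u e) := by
  simp only [Finset.prod_map, Fin.valEmbedding_apply, letter_val]

theorem blockSize_eq_sum_letter (l : Fin (r + 1)) :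
    blockSize s l = ∑ e ∈ Finset.Ico (l : ℕ) (r + 1), ((letter s u e).1 : ℕ) := by
  rw [← Fin.map_valEmbedding_Ici, sum_map_letter s u fun x => (x.1 : ℕ), blockSize]

theorem weight_word_letter : weight (word (letter s u) (r + 1)) = wt s := by
  have h0 : blockSize s 0 = wt s :=
    Finset.sum_congr (Finset.Ici_bot (α := Fin (r + 1))) fun _ _ => rfl
  rw [weight_word, Finset.range_eq_Ico, ← h0, blockSize_eq_sum_letter s u, Fin.val_zero]

theorem blockSize_add_weight_word (l : Fin (r + 1)) :
    blockSize s l + weight (word (letter s u) l) = wt s := by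
  rw [← weight_word_letter s u, weight_word, weight_word, blockSize_eq_sum_letter s u, add_comm,
    Finset.sum_range_add_sum_Ico _ l.isLt.le]

theorem blockSize_eq_add {l m : Fin (r + 1)} (h : l ≤ m) :
    blockSize s l = ∑ e ∈ Finset.Ico (l : ℕ) m, ((letter s u e).1 : ℕ) + blockSize s m := by
  rw [blockSize_eq_sum_letter s u, blockSize_eq_sum_letter s u,
    Finset.sum_Ico_consecutive _ h m.isLt.le]

variable [Fintype F]

theorem prod_Ico_term_letter {l m : Fin (r + 1)} (h : l ≤ m) (n : ℕ) :
    (∏ e ∈ Finset.Ico (l : ℕ) m, term (letter s u e) n) *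
        (toK F (lamProd F n))⁻¹ ^ blockSize s m =
      toK F (∏ e ∈ Finset.Ico l m, u e) ^ Fintype.card F ^ n *
        (toK F (lamProd F n))⁻¹ ^ blockSize s l := by
  rw [prod_term, blockSize_eq_add s u h, pow_add, mul_assoc, ← Fin.map_valEmbedding_Ico,
    prod_map_letter s u Prod.snd]

end Letter

section VecMul

variable {F : Type*} [Field F] {r : ℕ} (s : Fin (r + 1) → ℕ+) (u : Fin (r + 1) → F[X])

/-- The last coordinate of block `l`. -/
def lastOf (l : Fin (r + 1)) : Idx s :=
  ⟨l, ⟨blockSize s l - 1, Nat.sub_lt (blockSize_pos s l) Nat.one_pos⟩⟩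

variable {s}

theorem lastOf_snd_add_one (l : Fin (r + 1)) : ((lastOf s l).2 : ℕ) + 1 = blockSize s l :=
  Nat.sub_add_cancel (blockSize_pos s l)

theorem eq_lastOf {x : Idx s} (h : (x.2 : ℕ) + 1 = blockSize s x.1) : x = lastOf s x.1 :=
  Sigma.ext rfl (heq_of_eq (Fin.ext (Nat.eq_sub_of_add_eq h)))

theorem sum_eq_sum_lastOf {M : Type*} [AddCommMonoid M] {f : Idx s → M}
    (hf : ∀ x : Idx s, (x.2 : ℕ) + 1 ≠ blockSize s x.1 → f x = 0) :
    ∑ x, f x = ∑ l, f (lastOf s l) := by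
  rw [Fintype.sum_sigma]
  exact Finset.sum_congr rfl fun l _ => Fintype.sum_eq_single _ fun j hj =>
    hf ⟨l, j⟩ fun h => hj (eq_of_heq (Sigma.ext_iff.1 (eq_lastOf h)).2)

theorem matNK_lastOf (l : Fin (r + 1)) : matNK F s (lastOf s l) = 0 := by
  ext ⟨m, j⟩
  have hne : ¬ ((lastOf s l).1 = m ∧ ((lastOf s l).2 : ℕ) + 1 = j) := by
    rintro ⟨rfl, h⟩
    exact j.isLt.ne (h.symm.trans (lastOf_snd_add_one l))
  simp [matN, hne]

theorem vecMul_matNK_zero (f : Idx s → RatFunc F) (m : Fin (r + 1)) (h : 0 < blockSize s m) :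
    (f ᵥ* matNK F s) ⟨m, 0, h⟩ = 0 := by
  simp [Matrix.vecMul, dotProduct, matN]

theorem vecMul_matNK_succ (f : Idx s → RatFunc F) (m : Fin (r + 1)) {j : ℕ}
    (h : j + 1 < blockSize s m) :
    (f ᵥ* matNK F s) ⟨m, j + 1, h⟩ = f ⟨m, j, Nat.lt_of_succ_lt h⟩ := by
  refine (Fintype.sum_eq_single ⟨m, j, Nat.lt_of_succ_lt h⟩ ?_).trans ?_
  · rintro ⟨l, i⟩ hne
    have hli : ¬ (l = m ∧ (i : ℕ) = j) := by
      rintro ⟨rfl, hi⟩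
      exact hne (Sigma.ext rfl (heq_of_eq (Fin.ext hi)))
    simp [matN, hli]
  · simp [matN]

theorem vecMul_map_matE {K : Type*} [CommRing K] (φ : F[X] →+* K) (f : Idx s → K)
    (m : Fin (r + 1)) (j : Fin (blockSize s m)) :
    (f ᵥ* (matE s u).map φ) ⟨m, j⟩ = if (j : ℕ) = 0 then
      ∑ l ∈ Finset.Iic m, f (lastOf s l) * φ ((-1) ^ ((m : ℕ) - l) * ∏ e ∈ Finset.Ico l m, u e)
      else 0 := by
  have hE (l : Fin (r + 1)) : matE s u (lastOf s l) ⟨m, j⟩ = if l ≤ m ∧ (j : ℕ) = 0 then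
      (-1) ^ ((m : ℕ) - l) * ∏ e ∈ Finset.Ico l m, u e else 0 := by
    rw [matE, Matrix.of_apply]
    exact if_congr (and_congr_right fun _ => and_iff_right (lastOf_snd_add_one l)) rfl rfl
  rw [Matrix.vecMul, dotProduct, sum_eq_sum_lastOf fun x hx => by simp [matE, hx]]
  simp only [Matrix.map_apply, hE]
  by_cases hj : (j : ℕ) = 0 <;>
    simp [hj, apply_ite φ, ← Finset.sum_filter, Finset.filter_ge_eq_Iic]

theorem vecMul_injective_smul_sub_matNK {c : RatFunc F} (hc : c ≠ 0) :
    Function.Injective fun f : Idx s → RatFunc F => c • f - f ᵥ* matNK F s := by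
  have hunit : IsUnit (c • (1 : Matrix (Idx s) (Idx s) (RatFunc F)) + -matNK F s) :=
    (isNilpotent_matNK s).neg.isUnit_add_left_of_commute (isUnit_one.smul (Units.mk0 c hc))
      ((Commute.one_right _).smul_right _)
  convert Matrix.vecMul_injective_of_isUnit hunit using 2 with f
  rw [Matrix.vecMul_add, Matrix.vecMul_smul, Matrix.vecMul_one, Matrix.vecMul_neg, sub_eq_add_neg]

variable [Fintype F] (s)

/-- The row `lastOfFirst` of the `n`-th coefficient of the logarithm. -/
def logRow (n : ℕ) (x : Idx s) : RatFunc F :=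
  (-1) ^ (x.1 : ℕ) * toK F (lam F n) ^ (blockSize s x.1 - 1 - x.2) *
    ((toK F (lamProd F n))⁻¹ ^ blockSize s x.1 * starSum (word (letter s u) x.1) n)

theorem logRow_lastOf (n : ℕ) (l : Fin (r + 1)) :
    logRow s u n (lastOf s l) = (-1) ^ (l : ℕ) *
      ((toK F (lamProd F n))⁻¹ ^ blockSize s l * starSum (word (letter s u) l) n) := by
  simp [logRow, lastOf]

theorem logRow_zero : logRow s u 0 = Pi.single (lastOfFirst s) 1 := by
  have hlam : lam F 0 = 0 := by simp [lam]
  ext x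
  rw [logRow, starSum_word_zero, hlam, map_zero]
  by_cases hx : x = lastOfFirst s
  · subst hx
    simp [lastOfFirst, lamProd_zero]
  rw [Pi.single_eq_of_ne hx]
  by_cases h0 : x.1 = 0
  · have hpow : blockSize s x.1 - 1 - x.2 ≠ 0 := fun h => hx <| by
      have hlt := x.2.isLt
      rw [eq_lastOf (x := x) (by omega), h0]
      rfl
    rw [zero_pow hpow, mul_zero, zero_mul]
  · rw [if_neg (Fin.val_ne_zero_iff.2 h0), mul_zero, mul_zero]

theorem logRow_vecMul_matEK (n : ℕ) (m : Fin (r + 1)) (j : Fin (blockSize s m)) :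
    (logRow s u n ᵥ* (matEK s u).map (frob F n)) ⟨m, j⟩ = if (j : ℕ) = 0 then
      (-1) ^ (m : ℕ) * ((toK F (lamProd F n))⁻¹ ^ blockSize s m *
        starSum (word (letter s u) m) (n + 1)) else 0 := by
  refine (vecMul_map_matE u ((frob F n).comp (toK F)) _ m j).trans (if_congr Iff.rfl ?_ rfl)
  rw [starSum_word_succ, ← Fin.map_valEmbedding_Iic, Finset.sum_map, Finset.mul_sum,
    Finset.mul_sum]
  refine Finset.sum_congr rfl fun l hl => ?_
  have hlm : l ≤ m := Finset.mem_Iic.1 hl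
  have hsign : (-1 : RatFunc F) ^ (l : ℕ) * (-1) ^ ((m : ℕ) - l) = (-1) ^ (m : ℕ) := by
    rw [← pow_add, Nat.add_sub_cancel' hlm]
  rw [logRow_lastOf, RingHom.comp_apply, map_mul, map_mul, map_pow, map_pow, map_neg, map_neg,
    map_one, map_one, frob_apply, Fin.valEmbedding_apply]
  linear_combination (toK F (lamProd F n))⁻¹ ^ blockSize s l * starSum (word (letter s u) l) n *
      toK F (∏ e ∈ Finset.Ico l m, u e) ^ Fintype.card F ^ n * hsign -
    (-1) ^ (m : ℕ) * starSum (word (letter s u) l) n * prod_Ico_term_letter s u hlm n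

theorem logRow_succ (n : ℕ) :
    toK F (lam F (n + 1)) • logRow s u (n + 1) - logRow s u (n + 1) ᵥ* matNK F s =
      logRow s u n ᵥ* (matEK s u).map (frob F n) := by
  ext ⟨m, j, hj⟩
  rw [logRow_vecMul_matEK, Pi.sub_apply, Pi.smul_apply, smul_eq_mul]
  obtain _ | j := j
  · obtain ⟨d, hd⟩ : ∃ d, blockSize s m = d + 1 := Nat.exists_eq_succ_of_ne_zero hj.ne'
    have hcancel : toK F (lam F (n + 1)) ^ (d + 1) * (toK F (lam F (n + 1)))⁻¹ ^ (d + 1) = 1 := by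
      rw [← mul_pow, mul_inv_cancel₀ (toK_lam_ne_zero n.succ_ne_zero), one_pow]
    rw [vecMul_matNK_zero, sub_zero, if_pos rfl]
    simp only [logRow, lamProd_succ, map_mul, mul_inv, mul_pow, hd, Nat.add_sub_cancel,
      Nat.sub_zero]
    linear_combination (-1) ^ (m : ℕ) * ((toK F (lamProd F n))⁻¹ ^ (d + 1) *
      starSum (word (letter s u) m) (n + 1)) * hcancel
  · have hexp : blockSize s m - 1 - j = blockSize s m - 1 - (j + 1) + 1 := by omega
    rw [vecMul_matNK_succ, if_neg j.succ_ne_zero]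
    simp only [logRow, hexp, pow_succ]
    ring

variable {s u}

theorem LogRec.row_succ {P : TauSeries F (Idx s)} (hP : LogRec s u P) (n : ℕ) :
    toK F (lam F (n + 1)) • P (n + 1) (lastOfFirst s) -
        P (n + 1) (lastOfFirst s) ᵥ* matNK F s =
      P n (lastOfFirst s) ᵥ* (matEK s u).map (frob F n) := by
  have hN : matNK F s (lastOfFirst s) = 0 := matNK_lastOf 0
  have hNP : (matNK F s * P (n + 1)) (lastOfFirst s) = 0 := by
    rw [Matrix.mul_apply_eq_vecMul, hN, Matrix.zero_vecMul]
  ext x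
  have hx := congrFun (congrFun (hP.2 n) (lastOfFirst s)) x
  rw [Ring.lie_def, Matrix.add_apply, Matrix.sub_apply, congrFun hNP, Pi.zero_apply, zero_sub,
    ← sub_eq_add_neg] at hx
  exact hx

theorem LogRec.row_eq {P : TauSeries F (Idx s)} (hP : LogRec s u P) (n : ℕ) :
    P n (lastOfFirst s) = logRow s u n := by
  induction n with
  | zero =>
    rw [hP.1, logRow_zero]
    exact funext fun _ => Matrix.one_eq_pi_single
  | succ n ih =>
    refine vecMul_injective_smul_sub_matNK (toK_lam_ne_zero n.succ_ne_zero) ?_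
    beta_reduce
    rw [hP.row_succ, logRow_succ, ih]

end VecMul

/-! ### Partial sums of the logarithm -/

section StarSumsFromPowers

variable {F : Type*} [Field F] [Fintype F] {v : F[X]} {x : ℕ+ × F[X]}

-- The strict inner inequality is turned into a weak one by subtracting the diagonal.
theorem sum_term_mul_starSum_mem (hx : v ∣ x.2) (c : List (ℕ+ × F[X])) :
    (fun n => ∑ i ∈ Finset.range n, term x i * starSum c i) ∈ smallStarSpan v (x.1 + weight c) := by
  cases c with
  | nil => exact starSum_mem_smallStarSpan hx [] (weight_cons x [])
  | cons y c =>
    have hdiff : (fun n => ∑ i ∈ Finset.range n, term x i * starSum (y :: c) i) =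
        sumOp (term x) (starSum (y :: c)) - sumOp (term (x.1 + y.1, x.2 * y.2)) (starSum c) := by
      ext n
      rw [Pi.sub_apply, sumOp_apply, sumOp_apply, ← Finset.sum_sub_distrib]
      refine Finset.sum_congr rfl fun i _ => ?_
      rw [← term_mul_term, Pi.mul_apply, starSum, sumOp_succ]
      ring
    rw [hdiff]
    refine sub_mem (sumOp_term_mem_smallStarSpan hx (starSum_mem_starSpan _ rfl) rfl)
      (sumOp_term_mem_smallStarSpan (hx.mul_right _) (starSum_mem_starSpan c rfl) ?_)
    rw [weight_cons, PNat.add_coe, add_assoc]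

-- `λ_i y^(q^i) = θ y^(q^i) - (θ y)^(q^i)` removes one factor `λ_i`.
theorem sum_lam_pow_mul_term_mem (hx : v ∣ x.2) (e : ℕ) (c : List (ℕ+ × F[X])) :
    (fun n => ∑ i ∈ Finset.range n, toK F (lam F i) ^ e * (term x i * starSum c i)) ∈
      smallStarSpan v (x.1 + weight c) := by
  induction e generalizing x with
  | zero => simpa only [pow_zero, one_mul] using sum_term_mul_starSum_mem hx c
  | succ e ih =>
    have hterm (i : ℕ) : toK F (lam F i) * term x i =
        RatFunc.X * term x i - term (x.1, X * x.2) i := by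
      rw [toK_lam, term, term, map_mul, RatFunc.algebraMap_X, mul_pow]
      ring
    have hdiff : (fun n => ∑ i ∈ Finset.range n,
          toK F (lam F i) ^ (e + 1) * (term x i * starSum c i)) =
        (X : F[X]) • (fun n => ∑ i ∈ Finset.range n,
          toK F (lam F i) ^ e * (term x i * starSum c i)) -
        fun n => ∑ i ∈ Finset.range n,
          toK F (lam F i) ^ e * (term (x.1, X * x.2) i * starSum c i) := by
      ext n
      rw [Pi.sub_apply, Pi.smul_apply, Algebra.smul_def, RatFunc.algebraMap_X, Finset.mul_sum,
        ← Finset.sum_sub_distrib]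
      refine Finset.sum_congr rfl fun i _ => ?_
      linear_combination toK F (lam F i) ^ e * starSum c i * hterm i
    rw [hdiff]
    exact sub_mem (Submodule.smul_mem _ _ (ih hx)) (ih (x := (x.1, X * x.2)) (hx.mul_left X))

end StarSumsFromPowers

section TauK

variable {F : Type*} [Field F] [Fintype F] {ι : Type*}

/-- The `i`-th coordinatewise Frobenius twist `τ^i : A^d → k^d`. -/
def tauK (i : ℕ) : (ι → F[X]) →ₗ[F] ι → RatFunc F where
  toFun z x := frob F i (toK F (z x))
  map_add' y z := by
    ext x
    simp only [Pi.add_apply, map_add]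
  map_smul' a z := funext fun x => map_smul (((FiniteField.frobeniusAlgHom F (RatFunc F)) ^ i).comp
    (IsScalarTower.toAlgHom F F[X] (RatFunc F))) a (z x)

theorem tauK_apply (i : ℕ) (z : ι → F[X]) :
    tauK i z = fun x => toK F (z x) ^ Fintype.card F ^ i :=
  funext fun _ => frob_apply _ _

theorem tauK_tau (i : ℕ) (z : ι → F[X]) : tauK i (tau F ι z) = tauK (i + 1) z := by
  simp only [tauK_apply, tau_apply, map_pow, ← pow_mul, pow_succ']

theorem tauK_X_smul (i : ℕ) (z : ι → F[X]) :
    tauK i ((X : F[X]) • z) = (RatFunc.X ^ Fintype.card F ^ i : RatFunc F) • tauK i z := by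
  ext x
  simp [tauK_apply, mul_pow]

theorem tauK_mulVec [Fintype ι] (i : ℕ) (M : Matrix ι ι F[X]) (z : ι → F[X]) :
    tauK i (M *ᵥ z) = (M.map (toK F)).map (frob F i) *ᵥ tauK i z :=
  funext fun x => RingHom.map_mulVec ((frob F i).comp (toK F)) M z x

end TauK

section LogSum

variable {F : Type*} [Field F] [Fintype F] {v : F[X]} {r : ℕ}
variable (s : Fin (r + 1) → ℕ+) (u : Fin (r + 1) → F[X])

/-- The coordinate `lastOfFirst` of the `i`-th term of the logarithm, as a function of the point. -/
def logTerm (i : ℕ) : (Idx s → F[X]) →ₗ[F] RatFunc F where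
  toFun z := logRow s u i ⬝ᵥ tauK i z
  map_add' y z := by rw [map_add, dotProduct_add]
  map_smul' a z := by rw [map_smul, dotProduct_smul, RingHom.id_apply]

theorem logTerm_apply (i : ℕ) (z : Idx s → F[X]) : logTerm s u i z = logRow s u i ⬝ᵥ tauK i z := rfl

/-- The partial sums of the coordinate `lastOfFirst` of the logarithm. -/
def logSum (n : ℕ) : (Idx s → F[X]) →ₗ[F] RatFunc F := ∑ i ∈ Finset.range n, logTerm s u i

theorem logSum_apply (n : ℕ) (z : Idx s → F[X]) :
    logSum s u n z = ∑ i ∈ Finset.range n, logTerm s u i z := LinearMap.sum_apply _ _ _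

theorem logSum_mem {z : Idx s → F[X]} (hz : ∀ x, v ∣ z x) :
    (fun n => logSum s u n z) ∈ smallStarSpan v (wt s) := by
  have hsum : (fun n => logSum s u n z) = ∑ x : Idx s, (-1 : F[X]) ^ (x.1 : ℕ) • fun n =>
      ∑ i ∈ Finset.range n, toK F (lam F i) ^ (blockSize s x.1 - 1 - x.2) *
        (term (⟨blockSize s x.1, blockSize_pos s x.1⟩, z x) i *
          starSum (word (letter s u) x.1) i) := by
    ext n
    rw [Finset.sum_apply]
    simp only [logSum_apply, logTerm_apply, dotProduct]
    rw [Finset.sum_comm]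
    refine Finset.sum_congr rfl fun x _ => ?_
    rw [Pi.smul_apply, Algebra.smul_def, Finset.mul_sum]
    refine Finset.sum_congr rfl fun i _ => ?_
    rw [logRow, term, PNat.mk_coe, tauK_apply, map_pow, map_neg, map_one]
    ring
  rw [hsum]
  refine sum_mem fun x _ => Submodule.smul_mem _ _ ?_
  rw [← blockSize_add_weight_word s u x.1]
  exact sum_lam_pow_mul_term_mem (x := (⟨blockSize s x.1, blockSize_pos s x.1⟩, z x)) (hz x) _ _

theorem rhoT_apply (z : Idx s → F[X]) :
    rhoT s u z = (X : F[X]) • z + matN F s *ᵥ z + matE s u *ᵥ tau F _ z := by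
  rw [← Matrix.one_mulVec ((X : F[X]) • z), Matrix.mulVec_smul, ← Matrix.smul_mulVec,
    ← Matrix.add_mulVec]
  rfl

/-- The boundary term in the functional equation of the partial sums. -/
def logDefect (z : Idx s → F[X]) (i : ℕ) : RatFunc F :=
  (toK F (lam F i) • logRow s u i - logRow s u i ᵥ* matNK F s) ⬝ᵥ tauK i z

theorem logDefect_eq (z : Idx s → F[X]) (i : ℕ) :
    logDefect s u z i = toK F (lam F i) * logTerm s u i z - logTerm s u i (matN F s *ᵥ z) := by
  rw [logDefect, sub_dotProduct, smul_dotProduct, smul_eq_mul, ← dotProduct_mulVec, logTerm_apply,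
    logTerm_apply, tauK_mulVec, map_frob_matNK]

theorem logDefect_zero (z : Idx s → F[X]) : logDefect s u z 0 = 0 := by
  have hlam : lam F 0 = 0 := by simp [lam]
  have hN : matNK F s (lastOfFirst s) = 0 := matNK_lastOf 0
  rw [logDefect, hlam, map_zero, zero_smul, logRow_zero, Matrix.single_one_vecMul, Matrix.row, hN,
    sub_zero, zero_dotProduct]

theorem logTerm_rhoT (z : Idx s → F[X]) (i : ℕ) :
    logTerm s u i (rhoT s u z) =
      RatFunc.X * logTerm s u i z + (logDefect s u z (i + 1) - logDefect s u z i) := by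
  have hE : logTerm s u i (matE s u *ᵥ tau F _ z) = logDefect s u z (i + 1) := by
    rw [logTerm_apply, tauK_mulVec, tauK_tau, dotProduct_mulVec, logDefect, logRow_succ]
  have hX : logTerm s u i ((X : F[X]) • z) =
      RatFunc.X ^ Fintype.card F ^ i * logTerm s u i z := by
    rw [logTerm_apply, tauK_X_smul, dotProduct_smul, smul_eq_mul, logTerm_apply]
  rw [rhoT_apply, map_add, map_add, hE, hX, logDefect_eq s u z i, toK_lam]
  ring

theorem logSum_rhoT (z : Idx s → F[X]) (n : ℕ) :
    logSum s u n (rhoT s u z) = RatFunc.X * logSum s u n z + logDefect s u z n := by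
  simp only [logSum_apply, logTerm_rhoT, Finset.sum_add_distrib, Finset.sum_range_sub,
    logDefect_zero, Finset.mul_sum, sub_zero]

end LogSum

theorem dvd_mulVec {R m n : Type*} [NonUnitalCommSemiring R] [Fintype n] {a : R} {z : n → R}
    (M : Matrix m n R) (hz : ∀ x, a ∣ z x) (x : m) : a ∣ (M *ᵥ z) x :=
  Finset.dvd_sum fun b _ => (hz b).mul_left _

section LogCoord

variable {F : Type*} [Field F] [Fintype F] {v : F[X]} {hv : Irreducible v} {r : ℕ}
variable {s : Fin (r + 1) → ℕ+} {u : Fin (r + 1) → F[X]} {z : Idx s → F[X]} {y y' : Kv v hv}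

theorem dvd_rhoT (hz : ∀ x, v ∣ z x) (x : Idx s) : v ∣ rhoT s u z x := by
  rw [rhoT_apply]
  exact dvd_add (dvd_add ((hz x).mul_left _) (dvd_mulVec _ hz x))
    (dvd_mulVec _ (fun b => dvd_pow (hz b) Fintype.card_ne_zero) x)

theorem val_logTerm_le (hz : ∀ x, v ∣ z x) (n : ℕ) :
    val v hv (logTerm s u n z) ≤ WithZero.exp (-growth v (wt s) n) := by
  have hincr := val_sub_le_of_mem_smallStarSpan v hv (logSum_mem s u hz) n
  rwa [logSum_apply, logSum_apply, Finset.sum_range_succ, add_sub_cancel_left] at hincr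

theorem tendsto_logDefect (hz : ∀ x, v ∣ z x) :
    Tendsto (fun n => toKv v hv (logDefect s u z n)) atTop (𝓝 0) := by
  refine tendsto_zero_of_valued_le (tendsto_growth v (wt s)) fun n => ?_
  rw [valued_toKv, logDefect_eq]
  refine Valuation.map_sub_le _ ?_ (val_logTerm_le (dvd_mulVec _ hz) n)
  rw [map_mul]
  exact (mul_le_of_le_one_left' (val_toK_le_one v hv _)).trans (val_logTerm_le hz n)

variable (v hv s u) in
/-- `y` is the coordinate `lastOfFirst` of the logarithm at `z`. -/
def IsLogCoord (z : Idx s → F[X]) (y : Kv v hv) : Prop :=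
  Tendsto (fun n => toKv v hv (logSum s u n z)) atTop (𝓝 y)

theorem IsLogCoord.rhoT (hz : ∀ x, v ∣ z x) (h : IsLogCoord v hv s u z y) :
    IsLogCoord v hv s u (rhoT s u z) (toKv v hv RatFunc.X * y) := by
  simp only [IsLogCoord, logSum_rhoT, map_add, map_mul]
  simpa only [add_zero] using (h.const_mul _).add (tendsto_logDefect hz)

theorem IsLogCoord.rho (hz : ∀ x, v ∣ z x) (h : IsLogCoord v hv s u z y) (a : F[X]) :
    (∀ x, v ∣ rho s u a z x) ∧ IsLogCoord v hv s u (rho s u a z) (toKv v hv (toK F a) * y) := by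
  induction a using Polynomial.induction_on with
  | C a =>
    rw [CMSPL.rho, aeval_C, Module.algebraMap_end_apply]
    refine ⟨fun x => ?_, ?_⟩
    · rw [Pi.smul_apply, Polynomial.smul_eq_C_mul]
      exact (hz x).mul_left _
    · have hsmul (n : ℕ) : toKv v hv (logSum s u n (a • z)) =
          toKv v hv (toK F (C a)) * toKv v hv (logSum s u n z) := by
        rw [map_smul, Algebra.smul_def, map_mul, IsScalarTower.algebraMap_apply F F[X] (RatFunc F),
          Polynomial.algebraMap_eq]
      simpa only [IsLogCoord, hsmul] using h.const_mul _
  | add a b ha hb =>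
    rw [CMSPL.rho, map_add, LinearMap.add_apply]
    refine ⟨fun x => dvd_add (ha.1 x) (hb.1 x), ?_⟩
    simp only [IsLogCoord, map_add, add_mul]
    exact ha.2.add hb.2
  | monomial n a ih =>
    have hrho : CMSPL.rho s u (C a * X ^ (n + 1)) z =
        CMSPL.rhoT s u (CMSPL.rho s u (C a * X ^ n) z) := by
      rw [pow_succ', mul_left_comm, CMSPL.rho, map_mul, aeval_X]
      rfl
    have htoK : toKv v hv (toK F (C a * X ^ (n + 1))) * y =
        toKv v hv RatFunc.X * (toKv v hv (toK F (C a * X ^ n)) * y) := by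
      rw [pow_succ', mul_left_comm, map_mul, map_mul, RatFunc.algebraMap_X, mul_assoc]
    rw [hrho, htoK]
    exact ⟨dvd_rhoT ih.1, ih.2.rhoT ih.1⟩

theorem IsLogValue.isLogCoord {y : Idx s → Kv v hv} (h : IsLogValue v hv s u z y) :
    IsLogCoord v hv s u z (y (lastOfFirst s)) := by
  obtain ⟨P, hP, hy⟩ := h
  refine (Pi.hasSum.1 hy (lastOfFirst s)).tendsto_sum_nat.congr fun n => ?_
  rw [← map_sum, logSum_apply]
  refine congrArg _ (Finset.sum_congr rfl fun i _ => ?_)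
  rw [logTerm_apply, ← hP.logRec.row_eq, tauK_apply]
  rfl

end LogCoord

/-! ### Torsion of the reduction modulo `v` -/

section Residue

variable {F : Type*} [Field F] [Fintype F]

theorem frobeniusAlgHom_pow_apply {R : Type*} [CommRing R] [Algebra F R] (i : ℕ) (x : R) :
    (FiniteField.frobeniusAlgHom F R ^ i) x = x ^ Fintype.card F ^ i := by
  rw [AlgHom.coe_pow, FiniteField.coe_frobeniusAlgHom, pow_iterate]

theorem finite_adjoinRoot {F : Type*} [Field F] [Finite F] {v : F[X]} (hv : Irreducible v) :
    Finite (AdjoinRoot v) :=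
  have : Module.Finite F (AdjoinRoot v) := (AdjoinRoot.powerBasis hv.ne_zero).finite
  Module.finite_of_finite F

variable {v : F[X]}

theorem pow_card_pow_natDegree (hv : Irreducible v) (x : AdjoinRoot v) :
    x ^ Fintype.card F ^ v.natDegree = x := by
  have : Fact (Irreducible v) := ⟨hv⟩
  have := finite_adjoinRoot hv
  have := Fintype.ofFinite (AdjoinRoot v)
  have hrank : Module.finrank F (AdjoinRoot v) = v.natDegree :=
    finrank_quotient_span_eq_natDegree
  rw [← hrank, ← Module.card_eq_pow_finrank, FiniteField.pow_card]

theorem injOn_root_pow (hv : Irreducible v) :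
    Set.InjOn (fun k => AdjoinRoot.root v ^ Fintype.card F ^ k) (Set.Iio v.natDegree) := by
  have : Fact (Irreducible v) := ⟨hv⟩
  have := finite_adjoinRoot hv
  have hrank : Module.finrank F (AdjoinRoot v) = v.natDegree :=
    finrank_quotient_span_eq_natDegree
  have hinj := pow_injOn_Iio_orderOf (x := FiniteField.frobeniusAlgHom F (AdjoinRoot v))
  rw [FiniteField.orderOf_frobeniusAlgHom, hrank] at hinj
  refine fun i hi j hj h => hinj hi hj (AdjoinRoot.algHom_ext ?_)
  simpa only [frobeniusAlgHom_pow_apply] using h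

theorem map_eq_prod_X_sub_C_root_pow (hm : v.Monic) (hv : Irreducible v) :
    v.map (algebraMap F (AdjoinRoot v)) = ∏ k ∈ Finset.range v.natDegree,
      (X - C (AdjoinRoot.root v ^ Fintype.card F ^ k)) := by
  have : Fact (Irreducible v) := ⟨hv⟩
  have hmonic : (∏ k ∈ Finset.range v.natDegree,
      (X - C (AdjoinRoot.root v ^ Fintype.card F ^ k))).Monic :=
    monic_prod_of_monic _ _ fun k _ => monic_X_sub_C _
  refine (eq_of_dvd_of_natDegree_le_of_leadingCoeff
    (Finset.prod_dvd_of_coprime ?_ fun k _ => ?_) ?_ ?_).symm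
  · intro i hi j hj hij
    rw [Finset.coe_range] at hi hj
    exact isCoprime_X_sub_C_of_isUnit_sub
      (sub_ne_zero_of_ne ((injOn_root_pow hv).ne hi hj hij)).isUnit
  · rw [dvd_iff_isRoot, IsRoot.def, eval_map_algebraMap, ← frobeniusAlgHom_pow_apply,
      aeval_algHom_apply, AdjoinRoot.aeval_eq, AdjoinRoot.mk_self, map_zero]
  · rw [natDegree_map, natDegree_prod_of_monic _ _ fun k _ => monic_X_sub_C _]
    simp only [natDegree_X_sub_C, Finset.sum_const, Finset.card_range, smul_eq_mul, mul_one, le_rfl]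
  · rw [hmonic.leadingCoeff, (hm.map _).leadingCoeff]

end Residue

section Shift

/-- The shift of sequences, through which polynomials act on the iterates of an endomorphism. -/
def shift (K : Type*) [CommRing K] : Module.End K (ℕ → K) := LinearMap.funLeft K K Nat.succ

theorem shift_apply {K : Type*} [CommRing K] (g : ℕ → K) (n : ℕ) : shift K g n = g (n + 1) := rfl

theorem aeval_shift_apply {F K V : Type*} [Field F] [CommRing K] [Algebra F K] [AddCommGroup V]
    [Module F V] (T : Module.End F V) (f : V →ₗ[F] K) (a : F[X]) (z : V) (n : ℕ) :
    aeval (shift K) (a.map (algebraMap F K)) (fun m => f ((T ^ m) z)) n =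
      f ((T ^ n) (aeval T a z)) := by
  induction a using Polynomial.induction_on generalizing n with
  | C a =>
    rw [map_C, aeval_C, aeval_C, Module.algebraMap_end_apply, Module.algebraMap_end_apply,
      Pi.smul_apply, map_smul, map_smul, algebraMap_smul]
  | add a b ha hb =>
    rw [Polynomial.map_add, map_add, LinearMap.add_apply, Pi.add_apply, ha, hb, map_add,
      LinearMap.add_apply, map_add, map_add]
  | monomial k a ih =>
    rw [pow_succ', ← mul_assoc, mul_comm (C a), mul_assoc, Polynomial.map_mul, map_X, map_mul,
      aeval_X, Module.End.mul_apply, shift_apply, ih, map_mul (aeval T) X, aeval_X,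
      Module.End.mul_apply, pow_succ, Module.End.mul_apply]

end Shift

section CarlitzTower

variable {F : Type*} [Field F] [Fintype F] {K : Type*} [CommRing K] [Algebra F K]

/-- The sequences `c_0, …, c_(d-1)` are the coordinates of an orbit of `t` on the `d`-th tensor
power of the Carlitz module over `K`, where `θ` acts as `x`; `c_d` is an auxiliary sequence. -/
structure IsCarlitzTower (F : Type*) [Field F] [Fintype F] {K : Type*} [CommRing K] (x : K) (d : ℕ)
    (c : ℕ → ℕ → K) : Prop where
  succ : ∀ j < d, ∀ n, c j (n + 1) = x * c j n + c (j + 1) n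
  top : ∀ n, c d n = c 0 n ^ Fintype.card F

variable {x : K} {d : ℕ} {c : ℕ → ℕ → K}

theorem IsCarlitzTower.aeval_shift_pow (hc : IsCarlitzTower F x d c) (k : ℕ) {j : ℕ} (hj : j ≤ d) :
    aeval (shift K) ((X - C (x ^ Fintype.card F ^ k)) ^ j)
      (fun n => c 0 n ^ Fintype.card F ^ k) = fun n => c j n ^ Fintype.card F ^ k := by
  induction j with
  | zero => simp
  | succ j ih =>
    rw [pow_succ', map_mul, Module.End.mul_apply, ih (Nat.le_of_succ_le hj)]
    ext n
    rw [map_sub, aeval_X, aeval_C, LinearMap.sub_apply, Pi.sub_apply, shift_apply,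
      Module.algebraMap_end_apply, Pi.smul_apply, smul_eq_mul, hc.succ j hj,
      ← frobeniusAlgHom_pow_apply, map_add, map_mul]
    simp only [frobeniusAlgHom_pow_apply]
    ring

theorem IsCarlitzTower.aeval_shift_prod (hc : IsCarlitzTower F x d c) (m : ℕ) :
    aeval (shift K) (∏ k ∈ Finset.range m, (X - C (x ^ Fintype.card F ^ k)) ^ d) (c 0) =
      fun n => c 0 n ^ Fintype.card F ^ m := by
  induction m with
  | zero => simp
  | succ m ih =>
    rw [Finset.prod_range_succ, mul_comm, map_mul, Module.End.mul_apply, ih,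
      hc.aeval_shift_pow m le_rfl]
    ext n
    rw [hc.top, ← pow_mul, ← pow_succ']

-- Modulo `v`, `v^d = ∏_k (t - θ^(q^k))^d` acts on `c_0` as the `q^(deg v)`-th power map.
theorem IsCarlitzTower.aeval_shift_pow_sub_one {v : F[X]} (hm : v.Monic) (hv : Irreducible v)
    {c : ℕ → ℕ → AdjoinRoot v} (hc : IsCarlitzTower F (AdjoinRoot.root v) d c) {j : ℕ}
    (hj : j ≤ d) :
    aeval (shift (AdjoinRoot v)) ((v ^ d - 1).map (algebraMap F (AdjoinRoot v))) (c j) = 0 := by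
  have hzero :
      aeval (shift (AdjoinRoot v)) ((v ^ d - 1).map (algebraMap F (AdjoinRoot v))) (c 0) = 0 := by
    rw [Polynomial.map_sub, Polynomial.map_pow, map_eq_prod_X_sub_C_root_pow hm hv,
      ← Finset.prod_pow, map_sub, LinearMap.sub_apply, hc.aeval_shift_prod, Polynomial.map_one,
      map_one]
    ext n
    simp [pow_card_pow_natDegree hv]
  have hcj : aeval (shift (AdjoinRoot v)) ((X - C (AdjoinRoot.root v)) ^ j) (c 0) = c j := by
    simpa only [pow_zero, pow_one] using hc.aeval_shift_pow 0 hj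
  rw [← hcj, ← Module.End.mul_apply, ← map_mul, mul_comm, map_mul, Module.End.mul_apply, hzero,
    map_zero]

end CarlitzTower

section Coordinates

variable {F : Type*} [Field F] {r : ℕ} {s : Fin (r + 1) → ℕ+}

/-- The first coordinate of block `l`. -/
def firstOf (s : Fin (r + 1) → ℕ+) (l : Fin (r + 1)) : Idx s := ⟨l, 0, blockSize_pos s l⟩

theorem matN_mulVec_lastOf (z : Idx s → F[X]) (l : Fin (r + 1)) :
    (matN F s *ᵥ z) (lastOf s l) = 0 := by
  refine Finset.sum_eq_zero fun ⟨m, i⟩ _ => mul_eq_zero_of_left (if_neg ?_) _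
  rintro ⟨rfl, h⟩
  exact i.isLt.ne (h.symm.trans (lastOf_snd_add_one l))

theorem matN_mulVec_of_lt (z : Idx s → F[X]) (l : Fin (r + 1)) {j : ℕ}
    (h : j + 1 < blockSize s l) :
    (matN F s *ᵥ z) ⟨l, j, Nat.lt_of_succ_lt h⟩ = z ⟨l, j + 1, h⟩ := by
  refine (Fintype.sum_eq_single ⟨l, j + 1, h⟩ ?_).trans ?_
  · rintro ⟨m, i⟩ hne
    refine mul_eq_zero_of_left (if_neg ?_) _
    rintro ⟨rfl, hi⟩
    exact hne (Sigma.ext rfl (heq_of_eq (Fin.ext hi.symm)))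
  · simp [matN]

theorem matE_of_lt (u : Fin (r + 1) → F[X]) (l : Fin (r + 1)) {j : ℕ}
    (h : j + 1 < blockSize s l) : matE s u ⟨l, j, Nat.lt_of_succ_lt h⟩ = 0 :=
  funext fun _ => if_neg fun h' => h.ne h'.2.1

theorem matE_of_not_le (u : Fin (r + 1) → F[X]) {x y : Idx s} (h : ¬ x.1 ≤ y.1) :
    matE s u x y = 0 :=
  if_neg fun h' => h h'.1

theorem matE_lastOf_self (u : Fin (r + 1) → F[X]) (l : Fin (r + 1)) (j : Fin (blockSize s l)) :
    matE s u (lastOf s l) ⟨l, j⟩ = if (j : ℕ) = 0 then 1 else 0 := by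
  have hiff : (l ≤ l ∧ ((lastOf s l).2 : ℕ) + 1 = blockSize s l ∧ (j : ℕ) = 0) ↔ (j : ℕ) = 0 :=
    (and_iff_right le_rfl).trans (and_iff_right (lastOf_snd_add_one l))
  refine (if_congr hiff ?_ rfl)
  simp [lastOf]

end Coordinates

section Vanishing

variable {F : Type*} [Field F] {r : ℕ} {s : Fin (r + 1) → ℕ+} {v : F[X]} {z : Idx s → F[X]}

variable (s v) in
/-- The points whose blocks from the `k`-th on vanish modulo `v`. -/
def vanishing (k : ℕ) : Submodule F (Idx s → F[X]) where
  carrier := {z | ∀ x : Idx s, k ≤ x.1 → v ∣ z x}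
  add_mem' hz hz' x hx := dvd_add (hz x hx) (hz' x hx)
  zero_mem' _ _ := dvd_zero _
  smul_mem' a z hz x hx := by
    rw [Pi.smul_apply, Polynomial.smul_eq_C_mul]
    exact (hz x hx).mul_left _

variable [Fintype F] (s) (u : Fin (r + 1) → F[X])

theorem rhoT_apply_of_lt (z : Idx s → F[X]) (l : Fin (r + 1)) {j : ℕ} (h : j + 1 < blockSize s l) :
    rhoT s u z ⟨l, j, Nat.lt_of_succ_lt h⟩ =
      X * z ⟨l, j, Nat.lt_of_succ_lt h⟩ + z ⟨l, j + 1, h⟩ := by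
  rw [rhoT_apply, Pi.add_apply, Pi.add_apply, matN_mulVec_of_lt z l h, Pi.smul_apply,
    smul_eq_mul, Matrix.mulVec, matE_of_lt u l h, zero_dotProduct, add_zero]

theorem rhoT_apply_lastOf (z : Idx s → F[X]) (l : Fin (r + 1)) :
    rhoT s u z (lastOf s l) =
      X * z (lastOf s l) + ∑ y, matE s u (lastOf s l) y * z y ^ Fintype.card F := by
  rw [rhoT_apply, Pi.add_apply, Pi.add_apply, matN_mulVec_lastOf, add_zero]
  rfl

variable {s}

theorem vanishing_le_comap_rhoT (k : ℕ) :
    vanishing s v k ≤ (vanishing s v k).comap (rhoT s u) := by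
  intro z hz x hx
  change v ∣ rhoT s u z x
  by_cases h : (x.2 : ℕ) + 1 < blockSize s x.1
  · obtain ⟨l, j, hj⟩ := x
    rw [rhoT_apply_of_lt s u z l h]
    exact dvd_add ((hz _ hx).mul_left _) (hz ⟨l, _⟩ hx)
  · rw [eq_lastOf (le_antisymm x.2.isLt (not_lt.1 h)), rhoT_apply_lastOf]
    refine dvd_add ((hz (lastOf s x.1) hx).mul_left _) (Finset.dvd_sum fun y _ => ?_)
    by_cases hy : x.1 ≤ y.1
    · exact (dvd_pow (hz y (hx.trans hy)) Fintype.card_ne_zero).mul_left _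
    · have hE : matE s u (lastOf s x.1) y = 0 := matE_of_not_le u hy
      rw [hE, zero_mul]
      exact dvd_zero _

theorem mk_rhoT_lastOf {l : Fin (r + 1)} (hz : z ∈ vanishing s v (l + 1)) :
    AdjoinRoot.mk v (rhoT s u z (lastOf s l)) =
      AdjoinRoot.root v * AdjoinRoot.mk v (z (lastOf s l)) +
        AdjoinRoot.mk v (z (firstOf s l)) ^ Fintype.card F := by
  rw [rhoT_apply_lastOf, map_add, map_mul, AdjoinRoot.mk_X, map_sum,
    Fintype.sum_eq_single (firstOf s l), firstOf, matE_lastOf_self, if_pos rfl, one_mul, map_pow]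
  rintro ⟨m, i⟩ hne
  rcases lt_trichotomy l m with h | rfl | h
  · exact AdjoinRoot.mk_eq_zero.2 ((dvd_pow (hz ⟨m, i⟩ h) Fintype.card_ne_zero).mul_left _)
  · have hi : (i : ℕ) ≠ 0 := fun hi => hne (Sigma.ext rfl (heq_of_eq (Fin.ext hi)))
    rw [matE_lastOf_self, if_neg hi, zero_mul, map_zero]
  · rw [matE_of_not_le u (not_le.2 h), zero_mul, map_zero]

variable (v z) in
/-- The orbit of `z` under `t` modulo `v`, in block `l`, with the top sequence required by
`IsCarlitzTower`. -/
def orbit (l : Fin (r + 1)) (j n : ℕ) : AdjoinRoot v :=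
  if h : j < blockSize s l then AdjoinRoot.mk v ((rhoT s u ^ n) z ⟨l, j, h⟩)
  else AdjoinRoot.mk v ((rhoT s u ^ n) z (firstOf s l)) ^ Fintype.card F

theorem isCarlitzTower_orbit {l : Fin (r + 1)} (hz : z ∈ vanishing s v (l + 1)) :
    IsCarlitzTower F (AdjoinRoot.root v) (blockSize s l) (orbit v z u l) where
  succ j hj n := by
    have hmem : (rhoT s u ^ n) z ∈ vanishing s v (l + 1) :=
      Module.End.pow_apply_mem_of_forall_mem n (vanishing_le_comap_rhoT u _) z hz
    rw [orbit, orbit, orbit, dif_pos hj, dif_pos hj, pow_succ', Module.End.mul_apply]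
    split_ifs with h
    · rw [rhoT_apply_of_lt s u _ l h, map_add, map_mul, AdjoinRoot.mk_X]
    · rw [eq_lastOf (x := ⟨l, j, hj⟩) (le_antisymm hj (not_lt.1 h))]
      exact mk_rhoT_lastOf u hmem
  top n := by
    rw [orbit, orbit, dif_neg (lt_irrefl _), dif_pos (blockSize_pos s l)]
    rfl

theorem rho_pow_sub_one_mem_vanishing (hm : v.Monic) (hv : Irreducible v) {l : Fin (r + 1)}
    (hz : z ∈ vanishing s v (l + 1)) :
    rho s u (v ^ blockSize s l - 1) z ∈ vanishing s v l := by
  rintro ⟨m, j, hj⟩ hlm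
  rcases hlm.eq_or_lt with h | h
  · obtain rfl : l = m := Fin.ext h
    let coord : (Idx s → F[X]) →ₗ[F] AdjoinRoot v :=
      (AdjoinRoot.mkₐ v).toLinearMap ∘ₗ LinearMap.proj ⟨l, j, hj⟩
    have horbit : orbit v z u l j = fun n => coord ((rhoT s u ^ n) z) := funext fun _ => dif_pos hj
    have hzero := (isCarlitzTower_orbit u hz).aeval_shift_pow_sub_one hm hv hj.le
    rw [horbit] at hzero
    have hcoord := congrFun hzero 0
    rw [aeval_shift_apply] at hcoord
    exact AdjoinRoot.mk_eq_zero.1 hcoord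
  · exact aeval_apply_smul_mem_of_le_comap hz _ _ (vanishing_le_comap_rhoT u _) ⟨m, j, hj⟩ h

theorem exists_rho_mem_vanishing (hm : v.Monic) (hv : Irreducible v) (z : Idx s → F[X]) {k : ℕ}
    (hk : k ≤ r + 1) : ∃ a, ¬ v ∣ a ∧ rho s u a z ∈ vanishing s v k := by
  induction hk using Nat.decreasingInduction with
  | self =>
    exact ⟨1, fun h => hv.not_isUnit (isUnit_of_dvd_one h), fun x hx => absurd x.1.isLt hx.not_gt⟩
  | of_succ k hk ih =>
    obtain ⟨a, ha, hz⟩ := ih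
    refine ⟨(v ^ blockSize s ⟨k, hk⟩ - 1) * a, fun h => ?_, ?_⟩
    · refine (hv.prime.dvd_or_dvd h).elim (fun h' => hv.not_isUnit (isUnit_of_dvd_one ?_)) ha
      exact (dvd_sub_right (dvd_pow_self v (blockSize_pos s _).ne')).1 h'
    · rw [rho, map_mul]
      exact rho_pow_sub_one_mem_vanishing u hm hv (l := ⟨k, hk⟩) hz

theorem exists_rho_dvd (hm : v.Monic) (hv : Irreducible v) (z : Idx s → F[X]) :
    ∃ a, ¬ v ∣ a ∧ ∀ x, v ∣ rho s u a z x :=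
  (exists_rho_mem_vanishing u hm hv z (Nat.zero_le _)).imp fun _ h =>
    ⟨h.1, fun x => h.2 x (Nat.zero_le _)⟩

end Vanishing

/-! ### Polylogarithms as limits of star sums -/

section SpecialPoint

variable {F : Type*} [Field F] {r : ℕ} (s : Fin (r + 1) → ℕ+) (u : Fin (r + 1) → F[X])

theorem specialPoint_lastOf (l : Fin (r + 1)) :
    specialPoint s u (lastOf s l) = (-1) ^ (r - (l : ℕ)) * ∏ e ∈ Finset.Ici l, u e :=
  if_pos (lastOf_snd_add_one l)

variable [Fintype F]

theorem logRow_lastOf_mul_specialPoint (n : ℕ) (l : Fin (r + 1)) :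
    logRow s u n (lastOf s l) * toK F (specialPoint s u (lastOf s l)) ^ Fintype.card F ^ n =
      (-1) ^ r * (starSum (word (letter s u) l) n *
        ∏ e ∈ Finset.Ico (l : ℕ) (r + 1), term (letter s u e) n) := by
  have hsign : (-1 : RatFunc F) ^ r = (-1) ^ (l : ℕ) * (-1) ^ (r - (l : ℕ)) := by
    rw [← pow_add, Nat.add_sub_of_le (Nat.lt_succ_iff.1 l.isLt)]
  rw [specialPoint_lastOf, logRow_lastOf, prod_term, ← blockSize_eq_sum_letter,
    ← Fin.map_valEmbedding_Ici, prod_map_letter s u Prod.snd, hsign, ← frob_apply, ← frob_apply]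
  simp only [map_mul, map_pow, map_neg, map_one]
  ring

theorem logTerm_specialPoint (n : ℕ) :
    logTerm s u n (specialPoint s u) = (-1) ^ r *
      (starSum (word (letter s u) (r + 1)) (n + 1) - starSum (word (letter s u) (r + 1)) n) := by
  have hzero (x : Idx s) (hx : (x.2 : ℕ) + 1 ≠ blockSize s x.1) :
      logRow s u n x * tauK n (specialPoint s u) x = 0 := by
    have hx' : specialPoint s u x = 0 := if_neg hx
    simp only [tauK_apply, hx', map_zero]
    rw [zero_pow (pow_ne_zero _ Fintype.card_ne_zero), mul_zero]
  have hsum := Fin.sum_univ_eq_sum_range (fun l => (-1 : RatFunc F) ^ r *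
    (starSum (word (letter s u) l) n * ∏ e ∈ Finset.Ico l (r + 1), term (letter s u e) n)) (r + 1)
  rw [logTerm_apply, dotProduct, sum_eq_sum_lastOf hzero]
  simp only [tauK_apply, logRow_lastOf_mul_specialPoint]
  rw [hsum, ← Finset.mul_sum, starSum_word_succ, ← Nat.range_succ_eq_Iic,
    Finset.sum_range_succ _ (r + 1), Finset.Ico_self, Finset.prod_empty, mul_one,
    add_sub_cancel_right]

theorem logSum_specialPoint (n : ℕ) :
    logSum s u n (specialPoint s u) = (-1) ^ r * starSum (word (letter s u) (r + 1)) n := by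
  simp only [logSum_apply, logTerm_specialPoint]
  rw [← Finset.mul_sum, Finset.sum_range_sub, starSum_word_zero, if_neg r.succ_ne_zero, sub_zero]

end SpecialPoint

section Reversal

theorem word_eq_ofFn {α : Type*} (x : ℕ → α) (m : ℕ) :
    word x m = List.ofFn fun i : Fin m => x (Fin.rev i) := by
  induction m with
  | zero => rfl
  | succ m ih =>
    rw [word, ih, List.ofFn_succ]
    simp only [Fin.rev_zero, Fin.val_last, Fin.rev_succ, Fin.val_castSucc]

variable {F : Type*} [Field F] {r : ℕ} (s : Fin (r + 1) → ℕ+) (u : Fin (r + 1) → F[X])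

theorem word_letter_rev :
    word (letter (s ∘ Fin.rev) (u ∘ Fin.rev)) (r + 1) = List.ofFn fun i => (s i, u i) := by
  simp only [word_eq_ofFn, letter_val, Function.comp_apply, Fin.rev_rev]

theorem wt_rev : wt (s ∘ Fin.rev) = wt s := Equiv.sum_comp Fin.revPerm fun i => (s i : ℕ)

theorem wt_ne_zero : wt s ≠ 0 :=
  (Finset.sum_pos (fun i _ => (s i).pos) Finset.univ_nonempty).ne'

theorem weight_ofFn : weight (List.ofFn fun i => (s i, u i)) = wt s := by
  rw [← word_letter_rev, weight_word_letter, wt_rev]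

end Reversal

section Polylogarithm

variable {F : Type*} [Field F] [Fintype F] {v : F[X]} {hv : Irreducible v} {r : ℕ}
  {s : Fin (r + 1) → ℕ+} {u : Fin (r + 1) → F[X]}

variable (s u) in
/-- The point `ρ_a(v_{s̃,ũ})` at which the logarithm is evaluated in the definition of `Li*_s(u)_v`;
here `s̃`, `ũ` are `s`, `u` in reverse order. -/
def liPoint (a : F[X]) : Idx (s ∘ Fin.rev) → F[X] :=
  rho (s ∘ Fin.rev) (u ∘ Fin.rev) a (specialPoint (s ∘ Fin.rev) (u ∘ Fin.rev))

theorem liPoint_one : liPoint s u 1 = specialPoint (s ∘ Fin.rev) (u ∘ Fin.rev) := by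
  rw [liPoint, rho, map_one, Module.End.one_apply]

theorem rho_liPoint (a b : F[X]) :
    rho (s ∘ Fin.rev) (u ∘ Fin.rev) b (liPoint s u a) = liPoint s u (b * a) := by
  rw [liPoint, liPoint, rho, rho, rho, map_mul, Module.End.mul_apply]

theorem dvd_liPoint_one (hu : v ∣ u 0) (c : Idx (s ∘ Fin.rev)) : v ∣ liPoint s u 1 c := by
  rw [liPoint_one, specialPoint]
  split_ifs
  · have hlast : v ∣ (u ∘ Fin.rev) (Fin.last r) := by
      rwa [Function.comp_apply, Fin.rev_last]
    exact (hlast.trans (Finset.dvd_prod_of_mem _ (Finset.mem_Ici.2 (Fin.le_last _)))).mul_left _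
  · exact dvd_zero _

theorem isLi_iff {x : Kv v hv} :
    IsLi v hv s u x ↔ ∃ a ≠ 0, (∀ c, v ∣ liPoint s u a c) ∧
      ∃ y, IsLogCoord v hv (s ∘ Fin.rev) (u ∘ Fin.rev) (liPoint s u a) y ∧
        x = toKv v hv ((-1) ^ r / toK F a) * y := by
  have haeval (a : F[X]) : aeval (RatFunc.X : RatFunc F) a = toK F a := by
    rw [← RatFunc.algebraMap_X, aeval_algebraMap_apply, aeval_X_left_apply]
  refine exists_congr fun a => and_congr_right fun _ =>
    (and_congr_left' (forall_congr' fun c => val_toK_lt_one_iff v hv _)).trans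
      (and_congr_right fun hdvd => ⟨?_, ?_⟩)
  · rintro ⟨y, hy, rfl⟩
    exact ⟨_, hy.isLogCoord, by rw [haeval]⟩
  · rintro ⟨y, hy, rfl⟩
    obtain ⟨y', hy'⟩ := exists_isLogValue v hv (s ∘ Fin.rev) (u ∘ Fin.rev) hdvd
    exact ⟨y', hy', by rw [haeval, tendsto_nhds_unique hy hy'.isLogCoord]⟩

theorem IsLi.unique {x x' : Kv v hv} (hx : IsLi v hv s u x) (hx' : IsLi v hv s u x') : x = x' := by
  obtain ⟨a, ha, hav, y, hy, rfl⟩ := isLi_iff.1 hx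
  obtain ⟨b, hb, hbv, y', hy', rfl⟩ := isLi_iff.1 hx'
  have hba := (hy.rho hav b).2
  have hab := (hy'.rho hbv a).2
  rw [rho_liPoint] at hba hab
  rw [mul_comm] at hab
  have hlog : toKv v hv (toK F b) * y = toKv v hv (toK F a) * y' := tendsto_nhds_unique hba hab
  have ha' : toKv v hv (toK F a) ≠ 0 := by simpa using ha
  have hb' : toKv v hv (toK F b) ≠ 0 := by simpa using hb
  rw [map_div₀, map_div₀]
  field_simp
  linear_combination hlog

theorem isLi_of_tendsto (hu : v ∣ u 0) {x : Kv v hv}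
    (hx : Tendsto (fun n => toKv v hv (starSum (List.ofFn fun i => (s i, u i)) n)) atTop (𝓝 x)) :
    IsLi v hv s u x := by
  have hsign : toKv v hv ((-1) ^ r) * toKv v hv ((-1) ^ r) = 1 := by
    rw [← map_mul, ← pow_add, Even.neg_one_pow ⟨r, rfl⟩, map_one]
  refine isLi_iff.2 ⟨1, one_ne_zero, dvd_liPoint_one hu, toKv v hv ((-1) ^ r) * x, ?_, ?_⟩
  · refine (hx.const_mul _).congr fun n => ?_
    rw [liPoint_one, logSum_specialPoint, word_letter_rev, map_mul]
  · rw [map_one, div_one, ← mul_assoc, hsign, one_mul]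

theorem isLi_iff_tendsto (hu : v ∣ u 0) {x : Kv v hv} :
    IsLi v hv s u x ↔
      Tendsto (fun n => toKv v hv (starSum (List.ofFn fun i => (s i, u i)) n)) atTop (𝓝 x) := by
  refine ⟨fun hx => ?_, isLi_of_tendsto hu⟩
  have hmem : starSum (List.ofFn fun i => (s i, u i)) ∈ smallStarSpan v (wt s) := by
    rw [← weight_ofFn s u, List.ofFn_succ]
    exact starSum_mem_smallStarSpan hu _ rfl
  obtain ⟨x', hx', -⟩ := exists_tendsto_of_mem_smallStarSpan hv hmem
  rwa [hx.unique (isLi_of_tendsto hu hx')]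

end Polylogarithm

/-! ### The spaces spanned by polylogarithms -/

section Span

variable {F : Type*} [Field F] [Fintype F] {v : F[X]} (hv : Irreducible v)

variable (v) in
theorem mem_Sstar_iff {w : ℕ} (hw : w ≠ 0) {x : Kv v hv} :
    x ∈ Sstar v hv w ↔ ∃ (l : ℕ+ × F[X]) (c : List (ℕ+ × F[X])), v ∣ l.2 ∧ weight (l :: c) = w ∧
      Tendsto (fun n => toKv v hv (starSum (l :: c) n)) atTop (𝓝 x) := by
  rw [Sstar, if_neg hw]
  constructor
  · rintro ⟨r, s, u, rfl, hu, hx⟩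
    rw [isLi_iff_tendsto hu, List.ofFn_succ] at hx
    exact ⟨_, _, hu, by rw [← weight_ofFn s u, List.ofFn_succ], hx⟩
  · rintro ⟨l, c, hl, rfl, hx⟩
    let s : Fin (c.length + 1) → ℕ+ := fun i => ((l :: c).get i).1
    let u : Fin (c.length + 1) → F[X] := fun i => ((l :: c).get i).2
    have hget : (List.ofFn fun i => (s i, u i)) = l :: c := List.ofFn_get (l :: c)
    have hu : v ∣ u 0 := hl
    refine ⟨c.length, s, u, ?_, hu, ?_⟩
    · rw [← weight_ofFn s u, hget]
    · rwa [isLi_iff_tendsto hu, hget]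

variable {hv}

theorem mem_span_Sstar_of_tendsto {w : ℕ} (hw : w ≠ 0) {g : ℕ → RatFunc F}
    (hg : g ∈ smallStarSpan v w) {x : Kv v hv}
    (hx : Tendsto (fun n => toKv v hv (g n)) atTop (𝓝 x)) :
    x ∈ Submodule.span (RatFunc F) (Sstar v hv w) := by
  induction hg using Submodule.span_induction generalizing x with
  | mem g hg =>
    obtain ⟨l, c, hl, hc, rfl⟩ := hg
    exact Submodule.subset_span ((mem_Sstar_iff v hv hw).2 ⟨l, c, hl, hc, hx⟩)
  | zero =>
    obtain rfl : x = 0 :=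
      tendsto_nhds_unique hx (by simp only [Pi.zero_apply, map_zero, tendsto_const_nhds])
    exact zero_mem _
  | add g h hg hh ihg ihh =>
    obtain ⟨y, hy, -⟩ := exists_tendsto_of_mem_smallStarSpan hv hg
    obtain ⟨z, hz, -⟩ := exists_tendsto_of_mem_smallStarSpan hv hh
    obtain rfl : x = y + z := tendsto_nhds_unique hx
      ((hy.add hz).congr fun n => by rw [Pi.add_apply, map_add])
    exact add_mem (ihg hy) (ihh hz)
  | smul a g hg ih =>
    obtain ⟨y, hy, -⟩ := exists_tendsto_of_mem_smallStarSpan hv hg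
    obtain rfl : x = toKv v hv (toK F a) * y := tendsto_nhds_unique hx
      ((hy.const_mul _).congr fun n => by rw [← map_mul, Pi.smul_apply, Algebra.smul_def])
    rw [← Algebra.smul_def]
    exact Submodule.smul_mem _ _ (ih hy)

theorem IsLi.mem_span_Sstar {r : ℕ} {s : Fin (r + 1) → ℕ+} {u : Fin (r + 1) → F[X]} {x : Kv v hv}
    (hx : IsLi v hv s u x) : x ∈ Submodule.span (RatFunc F) (Sstar v hv (wt s)) := by
  obtain ⟨a, -, hav, y, hy, rfl⟩ := isLi_iff.1 hx
  have hmem := logSum_mem (s ∘ Fin.rev) (u ∘ Fin.rev) hav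
  rw [wt_rev] at hmem
  rw [← Algebra.smul_def]
  exact Submodule.smul_mem _ _ (mem_span_Sstar_of_tendsto (wt_ne_zero s) hmem hy)

variable (v hv)

theorem Sstar_subset_S (w : ℕ) : Sstar v hv w ⊆ S v hv w := by
  rw [Sstar, S]
  split_ifs
  · exact subset_rfl
  · rintro x ⟨r, s, u, hw, -, hx⟩
    exact ⟨r, s, u, hw, hx⟩

theorem L_eq_span_Sstar (w : ℕ) : L v hv w = Submodule.span (RatFunc F) (Sstar v hv w) := by
  refine le_antisymm (Submodule.span_le.2 fun x hx => ?_)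
    (Submodule.span_mono (Sstar_subset_S v hv w))
  rw [S] at hx
  split_ifs at hx with hw
  · refine Submodule.subset_span ?_
    rwa [Sstar, if_pos hw]
  · obtain ⟨r, s, u, rfl, hx⟩ := hx
    exact hx.mem_span_Sstar

theorem L_zero : L v hv 0 = 1 := by
  rw [L, S, if_pos rfl, Submodule.one_eq_span]

theorem L_mul_le (w w' : ℕ) : L v hv w * L v hv w' ≤ L v hv (w + w') := by
  rcases eq_or_ne w 0 with rfl | hw
  · rw [L_zero, one_mul, zero_add]
  rcases eq_or_ne w' 0 with rfl | hw'
  · rw [L_zero, mul_one, add_zero]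
  rw [L_eq_span_Sstar, L_eq_span_Sstar, L_eq_span_Sstar, Submodule.span_mul_span,
    Submodule.span_le]
  rintro _ ⟨x, hx, y, hy, rfl⟩
  obtain ⟨l, c, hl, rfl, hx'⟩ := (mem_Sstar_iff v hv hw).1 hx
  obtain ⟨m, d, hm, rfl, hy'⟩ := (mem_Sstar_iff v hv hw').1 hy
  refine mem_span_Sstar_of_tendsto (fun h => hw (Nat.eq_zero_of_add_eq_zero_right h))
    (starSum_mul_starSum_mem_smallStarSpan hl hm c d) ((hx'.mul hy').congr fun n => ?_)
  rw [Pi.mul_apply, map_mul]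

theorem gradedMonoid_L : SetLike.GradedMonoid (L v hv) where
  one_mem := Submodule.one_le.1 (L_zero v hv).ge
  mul_mem w w' _ _ hx hy := L_mul_le v hv w w' (Submodule.mul_mem_mul hx hy)

end Span

/-! ### Existence and integrality -/

section Existence

variable {F : Type*} [Field F] [Fintype F] {v : F[X]} {hv : Irreducible v} {r : ℕ}
  {s : Fin (r + 1) → ℕ+} {u : Fin (r + 1) → F[X]}

variable (hv s u) in
theorem exists_isLi_valued_le (hm : v.Monic) :
    ∃ x, IsLi v hv s u x ∧ Valued.v x ≤ WithZero.exp (-B v (wt s)) := by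
  obtain ⟨a, ha, hdvd⟩ := exists_rho_dvd (u ∘ Fin.rev) hm hv
    (specialPoint (s ∘ Fin.rev) (u ∘ Fin.rev))
  obtain ⟨y, hy, hle⟩ :=
    exists_tendsto_of_mem_smallStarSpan hv (logSum_mem (s ∘ Fin.rev) (u ∘ Fin.rev) hdvd)
  have ha0 : a ≠ 0 := fun h => ha (h ▸ dvd_zero v)
  have hunit : val v hv (toK F a) = 1 :=
    le_antisymm (val_toK_le_one v hv a) (not_lt.1 fun h => ha ((val_toK_lt_one_iff v hv a).1 h))
  refine ⟨_, isLi_iff.2 ⟨a, ha0, hdvd, y, hy, rfl⟩, ?_⟩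
  rwa [map_mul, valued_toKv, map_div₀, hunit, map_pow, Valuation.map_neg, map_one, one_pow, div_one,
    one_mul, ← wt_rev s]

variable (hv s u) in
theorem existsUnique_isLi (hm : v.Monic) : ∃! x : Kv v hv, IsLi v hv s u x := by
  obtain ⟨x, hx, -⟩ := exists_isLi_valued_le hv s u hm
  exact ⟨x, hx, fun _ hx' => hx'.unique hx⟩

theorem IsLi.valued_le (hm : v.Monic) {x : Kv v hv} (hx : IsLi v hv s u x) :
    Valued.v x ≤ WithZero.exp (-B v (wt s)) := by
  obtain ⟨x', hx', hle⟩ := exists_isLi_valued_le hv s u hm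
  rwa [hx.unique hx']

theorem B_nonneg (hv : Irreducible v) {w : ℕ} (hw : w ≤ qv v) : 0 ≤ B v w := by
  obtain ⟨n, hn⟩ := (B_isLeast hv w).1
  have hle : n * w ≤ qv v ^ n := by
    obtain _ | n := n
    · rw [zero_mul]
      exact Nat.zero_le _
    · rw [pow_succ]
      exact Nat.mul_le_mul (Nat.lt_pow_self (one_lt_qv hv)) hw
  rw [← hn]
  exact sub_nonneg.2 (mod_cast hle)

theorem IsLi.mem_adicCompletionIntegers (hm : v.Monic) {x : Kv v hv} (hx : IsLi v hv s u x)
    (hw : wt s ≤ qv v) : x ∈ (place v hv).adicCompletionIntegers (RatFunc F) := by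
  refine (HeightOneSpectrum.mem_adicCompletionIntegers _ _ _).2 ((hx.valued_le hm).trans ?_)
  rw [← WithZero.exp_zero, WithZero.exp_le_exp, neg_nonpos]
  exact B_nonneg hv hw

end Existence

end CMSPL

end

theorem corollary3 {F : Type*} [Field F] [Fintype F] (v : F[X]) (_hmonic : v.Monic)
    (hv : Irreducible v) :
    -- the values `Li*_s(u)_v` exist and are well defined
    (∀ (r : ℕ) (s : Fin (r + 1) → ℕ+) (u : Fin (r + 1) → F[X]),
      ∃! x : CMSPL.Kv v hv, CMSPL.IsLi v hv s u x) ∧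
    -- part (1)
    (∀ w : ℕ, CMSPL.L v hv w = Submodule.span (RatFunc F) (CMSPL.Sstar v hv w)) ∧
    (∃ R : Subalgebra (RatFunc F) (CMSPL.Kv v hv),
      Subalgebra.toSubmodule R = ⨆ w : ℕ, CMSPL.L v hv w) ∧
    -- part (2); `ord_v x ≥ b` is written as `|x|_v ≤ exp (-b)`
    (∀ (r : ℕ) (s : Fin (r + 1) → ℕ+) (u : Fin (r + 1) → F[X]) (x : CMSPL.Kv v hv),
      CMSPL.IsLi v hv s u x →
        Valued.v x ≤ WithZero.exp (-CMSPL.B v (CMSPL.wt s)) ∧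
        (CMSPL.wt s ≤ CMSPL.qv v →
          x ∈ (CMSPL.place v hv).adicCompletionIntegers (RatFunc F))) := by
  refine ⟨fun r s u => CMSPL.existsUnique_isLi hv s u _hmonic, CMSPL.L_eq_span_Sstar v hv, ?_,
    fun r s u x hx =>
      ⟨hx.valued_le _hmonic, fun hw => hx.mem_adicCompletionIntegers _hmonic hw⟩⟩
  have hgraded := CMSPL.gradedMonoid_L v hv
  exact ⟨(DirectSum.coeAlgHom (CMSPL.L v hv)).range, (Submodule.iSup_eq_toSubmodule_range _).symm⟩
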